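/- Let $X^{(1)},\dots,X^{(n)}$ be real random variables (low-fidelity outputs) and let $f(Y)$ be a random vector in $\mathbb R^{k_0}$. Fix a nonempty $S\subseteq[n]$, put $s=|S|$ and $X_S=(1,(X^{(i)})_{i\in S})^T\in\mathbb R^{s+1}$, $x_S=\mathbb E[X_S]$, $\Sigma_S=\mathrm{Cov}[X_S]$. Assume the linear model $$f(Y)=\beta_SX_S+\varepsilon_S,\qquad \beta_S\in\mathbb R^{k_0\times(s+1)},$$ where $\varepsilon_S$ is a centered sub-Gaussian random vector with covariance matrix $\Gamma_S$, independent of $X_S$. Assume moreover that, for some finite $K\ge 1$, $$\max\Big\{\sup_{\|\theta\|_2=1}\mathbb E[\langle X_S,\theta\rangle^4]^{1/4},\ \big\|\|X_S\|_2\big\|_{\psi_1}\Big\}\le K,\qquad \|W\|_{\psi_1}=\inf\{C>0:\mathbb E[e^{|W|/C}]\le 2\},$$ and that $\Lambda_S=\mathbb E[X_SX_S^T]=x_Sx_S^T+\Sigma_S$ is invertible. Let $(X^{(1)}_\ell,\dots,X^{(n)}_\ell,f(Y_\ell))_{\ell\ge1}$ be i.i.d. copies of $(X^{(1)},\dots,X^{(n)},f(Y))$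 (exploration samples) and let $(X_{S,\ell})_{\ell\ge1}$ be i.i.d. copies of $X_S$ that are independent of the exploration samples (exploitation samples). For $m\ge1$ let $Z_S\in\mathbb R^{m\times(s+1)}$ have the rows $(1,(X^{(i)}_\ell)_{i\in S})$, $\ell\le m$, let $Z_S^\dagger$ be its Moore–Penrose pseudoinverse, and let $\widehat\beta_S\in\mathbb R^{k_0\times(s+1)}$ be the least squares estimator, that is, $\widehat\beta_S^T=Z_S^\dagger\,(f(Y_1),\dots,f(Y_m))^T$. Let $c_0>0$ and $c_i>0$ be the costs of sampling $f(Y)$ and $X^{(i)}$. For a budget $B$ put $$N_S=\Big\lfloor \frac{B-m\sum_{i=0}^nc_i}{\sum_{i\in S}c_i}\Big\rfloor,\qquad \mathsf{LRMC}_S=\frac1{N_S}\sum_{\ell=1}^{N_S}\widehat\beta_SX_{S,\ell},$$ and, for a fixed matrix $Q\in\mathbb R^{q\times k_0}$ with arbitrary $q$, let $$\mathsf{Risk}_S|_{\widehat\beta_S}=\mathbb E\big[\|Q(\mathsf{LRMC}_S-\mathbb E[f(Y)])\|_2^2\,\big|\,\widehat\beta_S\big].$$ Then there are a constant $C>0$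 and an $m_0$, neither depending on $m$ or $B$, such that for every $m\ge m_0$ and every budget $B$ with $N_S\ge1$, with probability at least $1-m^{-2}$, $$\mathsf{Risk}_S|_{\widehat\beta_S}\le C\Big(\frac1{N_S}\operatorname{tr}(\Sigma_S\beta_S^TQ^TQ\beta_S)+(s+1)\operatorname{tr}(Q\Gamma_SQ^T)\frac{\log m}{m}\Big).$$ -/

import Mathlib

open MeasureTheory ProbabilityTheory Filter
open scoped ENNReal NNReal Matrix

namespace LRMC

/-- The `α`-Orlicz norm `inf {C > 0 : 𝔼[exp(|W|^α / C^α)] ≤ 2}` of a real random variable, as an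
extended nonnegative real (it is `∞` when no such `C` exists). -/
noncomputable def orliczNorm {Ω : Type*} [MeasurableSpace Ω] (α : ℝ) (W : Ω → ℝ)
    (μ : Measure Ω) : ℝ≥0∞ :=
  ⨅ (C : ℝ) (_ : 0 < C) (_ : ∫⁻ ω, ENNReal.ofReal (Real.exp (|W ω| ^ α / C ^ α)) ∂μ ≤ 2),
    ENNReal.ofReal C

/-- A centered sub-Gaussian random vector: all its marginals along unit vectors satisfy
`𝔼[exp(t⟨u, ε⟩)] ≤ exp(c t² / 2)` for all real `t`, with a common constant `c`. -/
def IsSubGaussianVector {Ω : Type*} [MeasurableSpace Ω] {k : ℕ} (ε : Ω → Fin k → ℝ)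
    (μ : Measure Ω) : Prop :=
  ∃ c : ℝ≥0, ∀ u : EuclideanSpace ℝ (Fin k), ‖u‖ = 1 →
    HasSubgaussianMGF (fun ω => ∑ j, u j * ε ω j) c μ

/-- The mean vector of a random vector. -/
noncomputable def meanVec {Ω ι : Type*} [MeasurableSpace Ω] (V : Ω → ι → ℝ) (μ : Measure Ω) :
    ι → ℝ :=
  fun i => ∫ ω, V ω i ∂μ

/-- The covariance matrix of a random vector. -/
noncomputable def covMatrix {Ω ι : Type*} [MeasurableSpace Ω] (V : Ω → ι → ℝ) (μ : Measure Ω) :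
    Matrix ι ι ℝ :=
  Matrix.of fun i j => cov[fun ω => V ω i, fun ω => V ω j; μ]

/-- The second moment matrix `𝔼[V Vᵀ]` of a random vector. -/
noncomputable def secondMomentMatrix {Ω ι : Type*} [MeasurableSpace Ω] (V : Ω → ι → ℝ)
    (μ : Measure Ω) : Matrix ι ι ℝ :=
  Matrix.of fun i j => ∫ ω, V ω i * V ω j ∂μ

/-- The four Penrose conditions: `B` is the Moore-Penrose pseudoinverse of `A`. -/
def IsMoorePenrose {ι κ : Type*} [Fintype ι] [Fintype κ] (A : Matrix ι κ ℝ)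
    (B : Matrix κ ι ℝ) : Prop :=
  A * B * A = A ∧ B * A * B = B ∧ (A * B)ᵀ = A * B ∧ (B * A)ᵀ = B * A

theorem exists_isMoorePenrose {ι κ : Type*} [Fintype ι] [Fintype κ] [DecidableEq κ]
    (A : Matrix ι κ ℝ) : ∃ B, IsMoorePenrose A B := by
  have hH : (Aᵀ * A).IsHermitian := by
    rw [← Matrix.conjTranspose_eq_transpose_of_trivial]
    exact Matrix.isHermitian_conjTranspose_mul_self A
  obtain ⟨G, hG, hHGH, hGHG, hc⟩ : ∃ G : Matrix κ κ ℝ, Gᵀ = G ∧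
      (Aᵀ * A) * G * (Aᵀ * A) = Aᵀ * A ∧ G * (Aᵀ * A) * G = G ∧
      (Aᵀ * A) * G = G * (Aᵀ * A) := by
    set U : Matrix κ κ ℝ := (hH.eigenvectorUnitary : Matrix κ κ ℝ) with hU
    set d := hH.eigenvalues with hd
    have hUU : Uᵀ * U = 1 := by
      have h := (Matrix.mem_unitaryGroup_iff' (A := U)).1 hH.eigenvectorUnitary.2
      rwa [Matrix.star_eq_conjTranspose, Matrix.conjTranspose_eq_transpose_of_trivial] at h
    have hspec : Aᵀ * A = U * Matrix.diagonal d * Uᵀ := by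
      have h := hH.spectral_theorem
      rw [Unitary.conjStarAlgAut_apply] at h
      rw [Matrix.star_eq_conjTranspose, Matrix.conjTranspose_eq_transpose_of_trivial] at h
      exact h
    have key : ∀ a b : κ → ℝ, (U * Matrix.diagonal a * Uᵀ) * (U * Matrix.diagonal b * Uᵀ) =
        U * Matrix.diagonal (fun i => a i * b i) * Uᵀ := by
      intro a b
      calc (U * Matrix.diagonal a * Uᵀ) * (U * Matrix.diagonal b * Uᵀ)
          = U * Matrix.diagonal a * (Uᵀ * U) * Matrix.diagonal b * Uᵀ := by
            simp only [Matrix.mul_assoc]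
        _ = _ := by
            rw [hUU, Matrix.mul_one, Matrix.mul_assoc U, Matrix.diagonal_mul_diagonal]
    refine ⟨U * Matrix.diagonal (fun i => (d i)⁻¹) * Uᵀ, ?_, ?_, ?_, ?_⟩
    · simp [Matrix.transpose_mul, Matrix.mul_assoc]
    · rw [hspec, key, key]
      congr 3; funext i; exact mul_inv_mul_cancel (d i)
    · rw [hspec, key, key]
      congr 3; funext i; simpa using mul_inv_mul_cancel (d i)⁻¹
    · rw [hspec, key, key]
      congr 3; funext i; exact mul_comm _ _
  refine ⟨G * Aᵀ, ?_, ?_, ?_, ?_⟩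
  · have h0 : (A * (G * Aᵀ) * A - A)ᵀ * (A * (G * Aᵀ) * A - A) = 0 := by
      have e1 : A * (G * Aᵀ) * A - A = A * (G * (Aᵀ * A) - 1) := by
        simp only [Matrix.mul_sub, Matrix.mul_assoc, Matrix.mul_one]
      have e2 : (Aᵀ * A) * (G * (Aᵀ * A) - 1) = 0 := by
        rw [Matrix.mul_sub, ← Matrix.mul_assoc, hHGH, Matrix.mul_one, sub_self]
      rw [e1, Matrix.transpose_mul, Matrix.mul_assoc, ← Matrix.mul_assoc Aᵀ, e2, Matrix.mul_zero]
    rw [← Matrix.conjTranspose_eq_transpose_of_trivial,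
      Matrix.conjTranspose_mul_self_eq_zero] at h0
    exact sub_eq_zero.1 h0
  · calc G * Aᵀ * A * (G * Aᵀ) = G * (Aᵀ * A) * G * Aᵀ := by simp only [Matrix.mul_assoc]
      _ = G * Aᵀ := by rw [hGHG]
  · simp only [Matrix.transpose_mul, Matrix.transpose_transpose, hG, Matrix.mul_assoc]
  · rw [Matrix.mul_assoc, Matrix.transpose_mul, hG, Matrix.transpose_mul,
      Matrix.transpose_transpose, hc]

/-- The Moore-Penrose pseudoinverse `A†`. It equals `(AᵀA)⁻¹Aᵀ` when `A` has full column rank. -/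
noncomputable def pinv {ι κ : Type*} [Fintype ι] [Fintype κ] [DecidableEq κ]
    (A : Matrix ι κ ℝ) : Matrix κ ι ℝ :=
  Classical.choose (exists_isMoorePenrose A)

/-- The regressor vector `(1, (x_i)_{i ∈ S})`; the index `none` is the intercept. -/
def regressor {n : ℕ} (S : Finset (Fin n)) (x : Fin n → ℝ) : Option S → ℝ
  | none => 1
  | some i => x i

/-- The design matrix of model `S`, whose rows are the regressor vectors of the first `m`
exploration samples. -/
def designMatrix {n : ℕ} (S : Finset (Fin n)) (m : ℕ) (x : ℕ → Fin n → ℝ) :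
    Matrix (Fin m) (Option S) ℝ :=
  Matrix.of fun l => regressor S (x l)

/-- The data matrix, whose rows are the responses of the first `m` exploration samples. -/
def responseMatrix {k : ℕ} (m : ℕ) (y : ℕ → Fin k → ℝ) : Matrix (Fin m) (Fin k) ℝ :=
  Matrix.of fun l => y l

/-- The least squares estimate of the coefficient matrix from the first `m` exploration samples:
its `j`-th row is `Z_S†` applied to the data vector of the `j`-th response. -/
noncomputable def lsCoef {n k : ℕ} (S : Finset (Fin n)) (m : ℕ)
    (d : ℕ → (Fin n → ℝ) × (Fin k → ℝ)) : Matrix (Fin k) (Option S) ℝ :=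
  (pinv (designMatrix S m fun l => (d l).1) * responseMatrix m fun l => (d l).2)ᵀ

/-- The linear regression Monte Carlo estimator with coefficient matrix `b` and `N` exploitation
samples `w 0, …, w (N - 1)` of the regressor vector. -/
noncomputable def lrmc {ι : Type*} [Fintype ι] {k : ℕ} (N : ℕ) (b : Matrix (Fin k) ι ℝ)
    (w : ℕ → ι → ℝ) : Fin k → ℝ :=
  (N : ℝ)⁻¹ • ∑ l ∈ Finset.range N, b *ᵥ w l

/-- The total cost of one exploration sample, `c₀` being the cost of the response. -/
def exploreCost {n : ℕ} (c₀ : ℝ) (c : Fin n → ℝ) : ℝ := c₀ + ∑ i, c i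

/-- The number of affordable exploitation samples of model `S` under the budget `B` after `m`
exploration samples. -/
noncomputable def numExploit {n : ℕ} (c₀ : ℝ) (c : Fin n → ℝ) (S : Finset (Fin n)) (B : ℝ)
    (m : ℕ) : ℕ :=
  ⌊(B - exploreCost c₀ c * m) / ∑ i ∈ S, c i⌋₊

/-- The conditional `Q`-risk `𝔼[‖Q (T - θ)‖₂² | b]` of the estimator `T` of `θ` given the random
matrix `b`, that is, given the σ-algebra generated by the entries of `b`. -/
noncomputable def condRisk {Ω ι : Type*} [MeasurableSpace Ω] {k q : ℕ}
    (Q : Matrix (Fin q) (Fin k) ℝ) (T : Ω → Fin k → ℝ) (θ : Fin k → ℝ)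
    (b : Ω → Matrix (Fin k) ι ℝ) (μ : Measure Ω) : Ω → ℝ≥0∞ :=
  condLExp (MeasurableSpace.comap (fun ω i j => b ω i j)
      (inferInstance : MeasurableSpace (Fin k → ι → ℝ))) μ
    fun ω => ENNReal.ofReal (‖WithLp.toLp 2 (Q *ᵥ (T ω - θ))‖ ^ 2)

end LRMC

/-! The exploitation samples are independent of `lsCoef`, so conditioning on the estimate amounts to
freezing it at a matrix `b` (`condLExp_comp_of_indepFun`). For frozen `b`, each row of the error is
the centered Monte Carlo error with the true coefficients, of variance of order `1 / N`, plus an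
average of `Q (b - β)` applied to the samples. The mean square of the latter is at most the
quadratic form of the second moment matrix at the rows of `Q (b - β)` (`lintegral_sq_norm_lrmc_le`).
It remains to bound the entries of `Q (b - β)` for the least squares estimate.

Let `a > 0` bound the second moment matrix from below. Truncation and Hoeffding's inequality give
`‖Z v‖² ≥ (a / 2) m ‖v‖²` for all `v`, outside an exponentially small event
(`exists_measureReal_not_coercive_le`). Then `Z† Z = 1`, so the coefficient error is `Z†` applied to
the residuals, and the rows of `Z†` have squared length at most `2 / (a m)`. Given the covariates,
an entry of `Q (b - β)` is therefore a sub-Gaussian sum with variance proxy of order `1 / m`; its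
square exceeds a multiple of `log m / m` with probability at most `2 / m³`
(`exists_measureReal_lt_sq_sum_le`). A union bound over the entries leaves total failure probability
below `1 / m²` for large `m`. -/

namespace LRMC

/-! ### Pseudoinverse: uniqueness, measurability, bounds under coercivity -/

section Pseudoinverse

variable {ι κ : Type*} [Fintype ι] [Fintype κ]

/-- `A * B` and `A * C` are both the orthogonal projection onto the range of `A`, and `B * A`, `C *
A` agree likewise; hence `B = B A B = C A B = C A C = C`. -/
theorem IsMoorePenrose.eq {A : Matrix ι κ ℝ} {B C : Matrix κ ι ℝ}
    (hB : IsMoorePenrose A B) (hC : IsMoorePenrose A C) : B = C := by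
  obtain ⟨b1, b2, b3, b4⟩ := hB
  obtain ⟨c1, c2, c3, c4⟩ := hC
  have hl : A * B = A * C := by
    calc A * B = (A * B)ᵀ := b3.symm
      _ = (A * C * (A * B))ᵀ := by rw [← Matrix.mul_assoc, c1]
      _ = A * B * (A * C) := by rw [Matrix.transpose_mul, b3, c3]
      _ = A * C := by rw [← Matrix.mul_assoc, b1]
  have hr : B * A = C * A := by
    calc B * A = (B * A)ᵀ := b4.symm
      _ = (B * A * (C * A))ᵀ := by rw [Matrix.mul_assoc, ← Matrix.mul_assoc A, c1]
      _ = C * A * (B * A) := by rw [Matrix.transpose_mul, b4, c4]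
      _ = C * A := by rw [Matrix.mul_assoc, ← Matrix.mul_assoc A, b1]
  calc B = B * A * B := b2.symm
    _ = C * (A * B) := by rw [hr, Matrix.mul_assoc]
    _ = C := by rw [hl, ← Matrix.mul_assoc, c2]

variable [DecidableEq κ]

theorem isMoorePenrose_pinv (A : Matrix ι κ ℝ) : IsMoorePenrose A (pinv A) :=
  Classical.choose_spec (exists_isMoorePenrose A)

theorem pinv_eq_iff {A : Matrix ι κ ℝ} {B : Matrix κ ι ℝ} : pinv A = B ↔ IsMoorePenrose A B :=
  ⟨fun h => h ▸ isMoorePenrose_pinv A, fun h => (isMoorePenrose_pinv A).eq h⟩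

/-- A function with closed graph into a σ-compact Hausdorff space is Borel measurable. -/
theorem measurable_of_isClosed_graph {X Y : Type*} [TopologicalSpace X] [MeasurableSpace X]
    [OpensMeasurableSpace X] [TopologicalSpace Y] [T2Space Y] [SigmaCompactSpace Y]
    [MeasurableSpace Y] [BorelSpace Y] {f : X → Y} (hf : IsClosed {p : X × Y | f p.1 = p.2}) :
    Measurable f := by
  -- The preimage of `K` is the projection of the graph over `K` along the compact factor `K`, and
  -- such projections are closed maps.
  have hK : ∀ K : Set Y, IsCompact K → IsClosed (f ⁻¹' K) := by
    intro K hK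
    have : CompactSpace K := isCompact_iff_compactSpace.1 hK
    have hc : IsClosed {p : X × K | f p.1 = p.2} :=
      hf.preimage (f := fun p : X × K => (p.1, (p.2 : Y))) (by fun_prop)
    convert isClosedMap_fst_of_compactSpace _ hc using 1
    ext x
    simp
  refine measurable_of_isClosed fun s hs => ?_
  have : f ⁻¹' s = ⋃ n, f ⁻¹' (s ∩ compactCovering Y n) := by
    rw [← Set.preimage_iUnion, ← Set.inter_iUnion, iUnion_compactCovering, Set.inter_univ]
  rw [this]
  exact MeasurableSet.iUnion fun n =>
    (hK _ ((isCompact_compactCovering Y n).inter_left hs)).measurableSet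

/-- The pseudoinverse is discontinuous where the rank drops, but the Penrose equations are closed
conditions on the pair `(A, B)` and determine `B`, so its graph is closed. -/
theorem measurable_pinv :
    Measurable fun (A : ι → κ → ℝ) (i : κ) (j : ι) => pinv (Matrix.of A) i j := by
  refine measurable_of_isClosed_graph ?_
  have : {p : (ι → κ → ℝ) × (κ → ι → ℝ) |
      (fun (i : κ) (j : ι) => pinv (Matrix.of p.1) i j) = p.2} =
      {p | IsMoorePenrose (Matrix.of p.1) (Matrix.of p.2)} := by
    ext p
    exact pinv_eq_iff (A := Matrix.of p.1) (B := Matrix.of p.2)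
  rw [this]
  have h1 : Continuous fun p : (ι → κ → ℝ) × (κ → ι → ℝ) => (Matrix.of p.1 : Matrix ι κ ℝ) :=
    continuous_fst
  have h2 : Continuous fun p : (ι → κ → ℝ) × (κ → ι → ℝ) => (Matrix.of p.2 : Matrix κ ι ℝ) :=
    continuous_snd
  exact ((isClosed_eq ((h1.matrix_mul h2).matrix_mul h1) h1).inter
    ((isClosed_eq ((h2.matrix_mul h1).matrix_mul h2) h2).inter
    ((isClosed_eq (h1.matrix_mul h2).matrix_transpose (h1.matrix_mul h2)).inter
    (isClosed_eq (h2.matrix_mul h1).matrix_transpose (h2.matrix_mul h1)))))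

/-- If `‖A v‖² ≥ a ‖v‖²` with `a > 0`, then `A†` is a left inverse of `A`. -/
theorem pinv_mul_self {A : Matrix ι κ ℝ} {a : ℝ} (ha : 0 < a)
    (hA : ∀ v : κ → ℝ, a * ∑ i, v i ^ 2 ≤ ∑ l, (A *ᵥ v) l ^ 2) : pinv A * A = 1 := by
  obtain ⟨h1, -, -, -⟩ := isMoorePenrose_pinv A
  refine Matrix.ext_iff_mulVec.2 fun v => ?_
  have h0 : A *ᵥ ((pinv A * A) *ᵥ v - v) = 0 := by
    rw [Matrix.mulVec_sub, Matrix.mulVec_mulVec, ← Matrix.mul_assoc, h1, sub_self]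
  have h := hA ((pinv A * A) *ᵥ v - v)
  rw [h0] at h
  have hs : ∑ i, ((pinv A * A) *ᵥ v - v) i ^ 2 = 0 := by
    refine le_antisymm ?_ (Finset.sum_nonneg fun i _ => sq_nonneg _)
    by_contra! hpos
    have := mul_pos ha hpos
    simp only [Pi.zero_apply, zero_pow two_ne_zero, Finset.sum_const_zero] at h
    linarith
  rw [Matrix.one_mulVec]
  ext i
  have := (Finset.sum_eq_zero_iff_of_nonneg fun i _ => sq_nonneg _).1 hs i (Finset.mem_univ i)
  simpa [sub_eq_zero] using this

/-- If `‖A v‖² ≥ a ‖v‖²` with `a > 0`, then the rows of `A†` have squared length at most `1/a`. -/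
theorem sum_sq_pinv_le {A : Matrix ι κ ℝ} {a : ℝ} (ha : 0 < a)
    (hA : ∀ v : κ → ℝ, a * ∑ i, v i ^ 2 ≤ ∑ l, (A *ᵥ v) l ^ 2) (i : κ) :
    ∑ l, pinv A i l ^ 2 ≤ 1 / a := by
  obtain ⟨-, h2, h3, -⟩ := isMoorePenrose_pinv A
  set P := pinv A
  -- Row `i` of `P` is `A w`, with `w` the `i`-th column of `P Pᵀ`, and its squared length is `w i`.
  -- Coercivity at `w` gives `a (w i)² ≤ w i`.
  have hAw : A * (P * Pᵀ) = Pᵀ := by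
    rw [← Matrix.mul_assoc, ← h3, ← Matrix.transpose_mul, ← Matrix.mul_assoc, h2]
  set w : κ → ℝ := fun j => (P * Pᵀ) j i with hw
  have hZw : ∀ l, (A *ᵥ w) l = P i l := fun l => congrFun (congrFun hAw l) i
  have hwi : w i = ∑ l, P i l ^ 2 := by
    simp [hw, Matrix.mul_apply, sq]
  have h := hA w
  simp_rw [hZw, ← hwi] at h
  have hle : w i ^ 2 ≤ ∑ j, w j ^ 2 :=
    Finset.single_le_sum (f := fun j => w j ^ 2) (fun j _ => sq_nonneg _) (Finset.mem_univ i)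
  rw [← hwi, le_div_iff₀ ha]
  by_contra! hlt
  have hwpos : 0 < w i := by
    by_contra! hn
    nlinarith
  nlinarith

/-- A positive semidefinite invertible matrix is bounded below by a positive multiple of the
identity. -/
theorem exists_pos_mul_le_of_posSemidef {Λ : Matrix κ κ ℝ} (hΛ : Λ.PosSemidef) (hu : IsUnit Λ) :
    ∃ a : ℝ, 0 < a ∧ ∀ v : κ → ℝ, a * ∑ i, v i ^ 2 ≤ v ⬝ᵥ Λ *ᵥ v := by
  have hpd : Λ.PosDef := hΛ.posDef_iff_isUnit.2 hu
  rcases isEmpty_or_nonempty κ with hκ | hκ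
  · exact ⟨1, one_pos, fun v => by simp⟩
  have hq : Continuous fun v : EuclideanSpace ℝ κ => v.ofLp ⬝ᵥ Λ *ᵥ v.ofLp := by
    simp only [dotProduct, Matrix.mulVec]
    fun_prop
  -- The constant is the minimum of the form on the unit sphere; homogeneity of degree two extends
  -- the bound to all vectors.
  obtain ⟨v₀, hv₀, hmin⟩ := (isCompact_sphere (0 : EuclideanSpace ℝ κ) 1).exists_isMinOn
    (NormedSpace.sphere_nonempty.2 zero_le_one) hq.continuousOn
  have hv₀' : v₀.ofLp ≠ 0 := by
    intro h
    have : v₀ = 0 := by ext i; simpa using congrFun h i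
    simp [this] at hv₀
  refine ⟨v₀.ofLp ⬝ᵥ Λ *ᵥ v₀.ofLp, by simpa using hpd.dotProduct_mulVec_pos hv₀', fun v => ?_⟩
  rcases eq_or_ne v 0 with rfl | hv
  · simp
  set V : EuclideanSpace ℝ κ := WithLp.toLp 2 v
  have hV : ‖V‖ ≠ 0 := by
    rw [norm_ne_zero_iff]
    intro h
    exact hv (by simpa [V] using congrArg WithLp.ofLp h)
  have hn : ‖V‖ ^ 2 = ∑ i, v i ^ 2 := by
    rw [EuclideanSpace.norm_sq_eq]; simp [V]
  have hmem : ‖V‖⁻¹ • V ∈ Metric.sphere (0 : EuclideanSpace ℝ κ) 1 := by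
    simp [norm_smul, hV]
  have h := hmin hmem
  have he : (‖V‖⁻¹ • V).ofLp ⬝ᵥ Λ *ᵥ (‖V‖⁻¹ • V).ofLp = (‖V‖ ^ 2)⁻¹ * (v ⬝ᵥ Λ *ᵥ v) := by
    simp only [WithLp.ofLp_smul, Matrix.mulVec_smul, smul_dotProduct, dotProduct_smul,
      smul_eq_mul, V]
    ring
  simp only [Set.mem_ofPred_eq, he] at h
  rw [← hn]
  have h2 : 0 < ‖V‖ ^ 2 := by positivity
  calc _ ≤ (‖V‖ ^ 2)⁻¹ * (v ⬝ᵥ Λ *ᵥ v) * ‖V‖ ^ 2 := by gcongr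
    _ = _ := by field_simp

end Pseudoinverse

/-- A quadratic form is perturbed by at most `δ · card · ‖v‖²` when each entry of the matrix is
perturbed by at most `δ`. -/
theorem abs_sum_mul_le {κ : Type*} [Fintype κ] {A : κ → κ → ℝ} {δ : ℝ}
    (hA : ∀ i j, |A i j| ≤ δ) (v : κ → ℝ) :
    |∑ i, ∑ j, v i * v j * A i j| ≤ δ * Fintype.card κ * ∑ i, v i ^ 2 := by
  calc |∑ i, ∑ j, v i * v j * A i j| ≤ ∑ i, ∑ j, (v i ^ 2 + v j ^ 2) / 2 * δ := by
        refine (Finset.abs_sum_le_sum_abs _ _).trans (Finset.sum_le_sum fun i _ => ?_)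
        refine (Finset.abs_sum_le_sum_abs _ _).trans (Finset.sum_le_sum fun j _ => ?_)
        rw [abs_mul]
        have h1 : |v i * v j| ≤ (v i ^ 2 + v j ^ 2) / 2 :=
          abs_le.2 ⟨by nlinarith [sq_nonneg (v i + v j)], by nlinarith [sq_nonneg (v i - v j)]⟩
        exact mul_le_mul h1 (hA i j) (abs_nonneg _) (by positivity)
    _ = _ := by
        simp_rw [← Finset.sum_mul, ← Finset.sum_div, Finset.sum_add_distrib, Finset.sum_const,
          ← Finset.smul_sum, Finset.card_univ, nsmul_eq_mul]
        ring

/-! ### Sub-Gaussian tails and Hoeffding's inequality -/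

section Tail

variable {Ω : Type*} [MeasurableSpace Ω] {μ : Measure Ω}

theorem hasSubgaussianMGF_mono {X : Ω → ℝ} {c d : ℝ≥0} (h : HasSubgaussianMGF X c μ)
    (hcd : c ≤ d) : HasSubgaussianMGF X d μ :=
  ⟨h.integrable_exp_mul, fun t => (h.mgf_le t).trans (by gcongr)⟩

/-- Since `1 + t 𝔼X ≤ 𝔼 exp(tX) ≤ exp(c t² / 2)`, the difference of the outer terms is nonnegative
in `t` and vanishes at `0`, so its derivative `-𝔼X` there is zero. -/
theorem integral_eq_zero_of_hasSubgaussianMGF [IsProbabilityMeasure μ] {X : Ω → ℝ} {c : ℝ≥0}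
    (h : HasSubgaussianMGF X c μ) : ∫ ω, X ω ∂μ = 0 := by
  set a := ∫ ω, X ω ∂μ with ha
  have hle : ∀ t : ℝ, 0 ≤ Real.exp (c * t ^ 2 / 2) - 1 - t * a := by
    intro t
    have h1 : ∫ ω, (1 + t * X ω) ∂μ ≤ mgf X μ t := by
      refine integral_mono ((integrable_const _).add (h.integrable.const_mul t))
        (h.integrable_exp_mul t) fun ω => ?_
      have := Real.add_one_le_exp (t * X ω)
      simp only
      linarith
    rw [integral_add (integrable_const _) (h.integrable.const_mul t), integral_const_mul] at h1
    simp only [integral_const, probReal_univ, smul_eq_mul, mul_one] at h1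
    linarith [h.mgf_le t]
  have hd : HasDerivAt (fun t : ℝ => Real.exp (c * t ^ 2 / 2) - 1 - t * a) (-a) 0 := by
    have h1 : HasDerivAt (fun t : ℝ => (c : ℝ) * t ^ 2 / 2) 0 0 := by
      simpa using (((hasDerivAt_id (0 : ℝ)).pow 2).const_mul (c : ℝ)).div_const 2
    have h2 : HasDerivAt (fun t : ℝ => Real.exp (c * t ^ 2 / 2) - 1 - t * a)
        (Real.exp (c * 0 ^ 2 / 2) * 0 - 1 * a) 0 :=
      (h1.exp.sub_const 1).sub ((hasDerivAt_id (0 : ℝ)).mul_const a)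
    simpa using h2
  have hmin : IsLocalMin (fun t : ℝ => Real.exp (c * t ^ 2 / 2) - 1 - t * a) 0 :=
    Eventually.of_forall fun t => by simpa using hle t
  simpa using hmin.hasDerivAt_eq_zero hd

/-- Two-sided tail bound for weighted sums of independent sub-Gaussian random variables. -/
theorem measureReal_le_abs_sum_le [IsProbabilityMeasure μ] {ι : Type*} [Fintype ι]
    {ζ : ι → Ω → ℝ} (hind : iIndepFun ζ μ) {c : ℝ≥0} (hsub : ∀ l, HasSubgaussianMGF (ζ l) c μ)
    (g : ι → ℝ) {b : ℝ≥0} (hg : ∑ l, g l ^ 2 ≤ b) {t : ℝ} (ht : 0 ≤ t) :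
    μ.real {ω | t ≤ |∑ l, g l * ζ l ω|} ≤ 2 * Real.exp (-t ^ 2 / (2 * (b * c))) := by
  have h1 : HasSubgaussianMGF (fun ω => ∑ l, g l * ζ l ω) (b * c) μ := by
    have hind' : iIndepFun (fun l ω => g l * ζ l ω) μ :=
      hind.comp (fun l x => g l * x) fun l => measurable_const_mul _
    refine hasSubgaussianMGF_mono (HasSubgaussianMGF.sum_of_iIndepFun hind'
      (s := Finset.univ) fun l _ => (hsub l).const_mul (g l)) ?_
    rw [← NNReal.coe_le_coe, NNReal.coe_sum, NNReal.coe_mul]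
    calc _ = ∑ l, g l ^ 2 * (c : ℝ) := Finset.sum_congr rfl fun l _ => NNReal.coe_mul _ _
      _ = (∑ l, g l ^ 2) * c := by rw [Finset.sum_mul]
      _ ≤ b * c := by gcongr
  have h2 := h1.measure_ge_le ht
  have h3 := h1.neg.measure_ge_le ht
  calc μ.real {ω | t ≤ |∑ l, g l * ζ l ω|}
      ≤ μ.real ({ω | t ≤ ∑ l, g l * ζ l ω} ∪ {ω | t ≤ (-fun ω => ∑ l, g l * ζ l ω) ω}) := by
        refine measureReal_mono fun ω hω => ?_
        have h : t ≤ |∑ l, g l * ζ l ω| := hω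
        exact le_abs.1 h
    _ ≤ _ := measureReal_union_le _ _
    _ ≤ _ := by push_cast at h2 h3; linarith

/-- Tail bound for sums of independent sub-Gaussian noise variables whose weights are functions of
independent covariates. -/
theorem measureReal_le_abs_sum_random_weights_le [IsProbabilityMeasure μ] {ι : Type*} [Fintype ι]
    {𝓥 : Type*} [MeasurableSpace 𝓥] {V : Ω → 𝓥} (hV : Measurable V) {η : Ω → ℝ}
    (hη : Measurable η) (hVη : IndepFun V η μ) {c : ℝ≥0} (hsub : HasSubgaussianMGF η c μ)
    {ζ : ι → Ω → 𝓥 × ℝ} (hζ : ∀ l, Measurable (ζ l)) (hind : iIndepFun ζ μ)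
    (hdist : ∀ l, IdentDistrib (ζ l) (fun ω => (V ω, η ω)) μ μ)
    {g : (ι → 𝓥) → ι → ℝ} (hg : Measurable g) (b : ℝ≥0) {t : ℝ} (ht : 0 ≤ t) :
    μ.real {ω | ∑ l, g (fun l => (ζ l ω).1) l ^ 2 ≤ b ∧
      t ≤ |∑ l, g (fun l => (ζ l ω).1) l * (ζ l ω).2|} ≤
      2 * Real.exp (-t ^ 2 / (2 * (b * c))) := by
  have := Measure.isProbabilityMeasure_map hV.aemeasurable (μ := μ)
  have := Measure.isProbabilityMeasure_map hη.aemeasurable (μ := μ)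
  set A : Set ((ι → 𝓥) × (ι → ℝ)) :=
    {p | ∑ l, g p.1 l ^ 2 ≤ b ∧ t ≤ |∑ l, g p.1 l * p.2 l|} with hA
  have hAm : MeasurableSet A := by
    have h1 : Measurable fun p : (ι → 𝓥) × (ι → ℝ) => ∑ l, g p.1 l ^ 2 := by fun_prop
    have h2 : Measurable fun p : (ι → 𝓥) × (ι → ℝ) => |∑ l, g p.1 l * p.2 l| := by fun_prop
    exact (measurableSet_le h1 measurable_const).inter (measurableSet_le measurable_const h2)
  -- All covariates are jointly independent of all noise variables, so Fubini allows the covariates,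
  -- and with them the weights, to be frozen.
  have hmap : μ.map (fun ω => ((fun l => (ζ l ω).1 : ι → 𝓥), (fun l => (ζ l ω).2 : ι → ℝ))) =
      (Measure.pi fun _ => μ.map V).prod (Measure.pi fun _ => μ.map η) := by
    have h1 : μ.map (fun ω l => ζ l ω) = Measure.pi fun _ => (μ.map V).prod (μ.map η) := by
      rw [(iIndepFun_iff_map_fun_eq_pi_map fun l => (hζ l).aemeasurable).1 hind]
      congr 1
      funext l
      rw [(hdist l).map_eq]
      exact (indepFun_iff_map_prod_eq_prod_map_map hV.aemeasurable hη.aemeasurable).1 hVη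
    rw [← (measurePreserving_arrowProdEquivProdArrow 𝓥 ℝ ι (fun _ => μ.map V)
      fun _ => μ.map η).map_eq, ← h1, Measure.map_map (MeasurableEquiv.measurable _)
      (measurable_pi_lambda _ hζ)]
    rfl
  have hindpi : iIndepFun (fun (l : ι) (y : ι → ℝ) => y l) (Measure.pi fun _ : ι => μ.map η) :=
    iIndepFun_pi (X := fun _ x => x) fun _ => aemeasurable_id
  have hsubpi : ∀ l : ι, HasSubgaussianMGF (fun y : ι → ℝ => y l) c
      (Measure.pi fun _ : ι => μ.map η) := by
    intro l
    refine HasSubgaussianMGF.of_map (X := id) (Y := fun y : ι → ℝ => y l)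
      (measurable_pi_apply l).aemeasurable ?_
    rw [(measurePreserving_eval (fun _ : ι => μ.map η) l).map_eq]
    exact (HasSubgaussianMGF.id_map_iff hη.aemeasurable).2 hsub
  have hbound : (μ.map (fun ω =>
      ((fun l => (ζ l ω).1 : ι → 𝓥), (fun l => (ζ l ω).2 : ι → ℝ)))) A ≤
      ENNReal.ofReal (2 * Real.exp (-t ^ 2 / (2 * (b * c)))) := by
    rw [hmap, Measure.prod_apply hAm]
    calc _ ≤ ∫⁻ _, ENNReal.ofReal (2 * Real.exp (-t ^ 2 / (2 * (b * c))))
          ∂(Measure.pi fun _ : ι => μ.map V) := by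
          refine lintegral_mono fun z => ?_
          -- The length constraint is part of the event: where it fails the slice is empty, so the
          -- bound is uniform in `z`.
          by_cases hz : ∑ l, g z l ^ 2 ≤ b
          · refine (measure_mono (t := {y : ι → ℝ | t ≤ |∑ l, g z l * y l|})
              fun y hy => hy.2).trans ?_
            rw [← ofReal_measureReal]
            exact ENNReal.ofReal_le_ofReal (measureReal_le_abs_sum_le hindpi hsubpi (g z) hz ht)
          · have : Prod.mk z ⁻¹' A = ∅ := by
              ext y
              simp [hA, hz]
            simp [this]
      _ = _ := by simp
  rw [Measure.map_apply (by fun_prop) hAm] at hbound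
  exact ENNReal.toReal_le_of_le_ofReal (by positivity) hbound

/-- Hoeffding's inequality for the empirical mean of a bounded function. -/
theorem measureReal_le_abs_empirical_sub_le [IsProbabilityMeasure μ] {𝓥 : Type*}
    [MeasurableSpace 𝓥] {V : Ω → 𝓥} {ζ : ℕ → Ω → 𝓥} (hind : iIndepFun ζ μ)
    (hdist : ∀ l, IdentDistrib (ζ l) V μ μ) {h : 𝓥 → ℝ} (hh : Measurable h) {M : ℝ}
    (hM : ∀ x, |h x| ≤ M) {m : ℕ} (hm : 0 < m) {δ : ℝ} (hδ : 0 ≤ δ) :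
    μ.real {ω | δ * m ≤ |∑ l : Fin m, h (ζ l ω) - m * ∫ ω, h (V ω) ∂μ|} ≤
      2 * Real.exp (-(δ ^ 2 / (2 * M ^ 2)) * m) := by
  have hM0 : 0 ≤ M := by
    obtain ⟨ω⟩ := nonempty_of_isProbabilityMeasure μ
    exact (abs_nonneg _).trans (hM (V ω))
  set c : ℝ≥0 := (‖M - -M‖₊ / 2) ^ 2 with hc
  have hc' : (c : ℝ) = M ^ 2 := by
    rw [hc]; push_cast
    rw [Real.norm_eq_abs, abs_of_nonneg (by linarith)]
    ring
  have hid : ∀ l, ∫ ω, h (ζ l ω) ∂μ = ∫ ω, h (V ω) ∂μ := fun l =>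
    ((hdist l).comp hh).integral_eq
  have hind' : iIndepFun (fun (l : Fin m) ω => h (ζ l ω) - ∫ ω, h (V ω) ∂μ) μ :=
    (hind.precomp Fin.val_injective).comp (fun _ x => h x - ∫ ω, h (V ω) ∂μ)
      fun _ => hh.sub_const _
  have hsub : ∀ l : Fin m, HasSubgaussianMGF (fun ω => h (ζ l ω) - ∫ ω, h (V ω) ∂μ) c μ := by
    intro l
    rw [← hid l]
    refine hasSubgaussianMGF_of_mem_Icc
      (hh.comp_aemeasurable (hdist l).aemeasurable_fst) ?_
    exact ae_of_all _ fun ω => abs_le.1 (hM _)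
  have key := measureReal_le_abs_sum_le hind' hsub (fun _ => 1) (b := m) (by simp)
    (t := δ * m) (by positivity)
  refine le_trans (le_of_eq ?_) (key.trans (le_of_eq ?_))
  · congr 1
    ext ω
    simp [Finset.sum_sub_distrib]
  · congr 2
    rw [hc']
    have : (m : ℝ) ≠ 0 := by positivity
    -- For `M = 0` both exponents are quotients by zero, hence `0`.
    rcases eq_or_ne M 0 with h0 | h0
    · simp [h0]
    · push_cast
      field_simp

end Tail

/-! ### Coercivity of the empirical second moment matrix -/

section DesignMatrix

variable {Ω κ : Type*} [MeasurableSpace Ω] {μ : Measure Ω} [Fintype κ]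

open Classical in
/-- The product `x i * x j`, set to zero unless all coordinates of `x` are at most `R` in absolute
value. -/
noncomputable def truncProd (R : ℝ) (i j : κ) (x : κ → ℝ) : ℝ :=
  if ∀ k, |x k| ≤ R then x i * x j else 0

theorem measurable_truncProd (R : ℝ) (i j : κ) : Measurable (truncProd R i j) := by
  unfold truncProd
  refine Measurable.ite ?_ (by fun_prop) measurable_const
  rw [Set.ofPred_forall]
  exact MeasurableSet.iInter fun k => measurableSet_le (by fun_prop) measurable_const

theorem abs_truncProd_le (R : ℝ) (i j : κ) (x : κ → ℝ) : |truncProd R i j x| ≤ R ^ 2 := by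
  unfold truncProd
  split_ifs with h
  · rw [abs_mul, sq]
    exact mul_le_mul (h i) (h j) (abs_nonneg _) ((abs_nonneg _).trans (h i))
  · simpa using sq_nonneg R

theorem abs_truncProd_le_abs_mul (R : ℝ) (i j : κ) (x : κ → ℝ) :
    |truncProd R i j x| ≤ |x i * x j| := by
  unfold truncProd
  split_ifs
  · rfl
  · rw [abs_zero]
    exact abs_nonneg _

theorem tendsto_integral_truncProd {V : Ω → κ → ℝ} (hV : Measurable V)
    (hV2 : ∀ i, MemLp (fun ω => V ω i) 2 μ) (i j : κ) :
    Tendsto (fun R : ℕ => ∫ ω, truncProd R i j (V ω) ∂μ) atTop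
      (nhds (∫ ω, V ω i * V ω j ∂μ)) := by
  refine tendsto_integral_of_dominated_convergence (fun ω => |V ω i * V ω j|)
    (fun R => ((measurable_truncProd R i j).comp hV).aestronglyMeasurable)
    ((hV2 i).integrable_mul (hV2 j)).abs
    (fun R => ae_of_all _ fun ω => abs_truncProd_le_abs_mul _ i j _) (ae_of_all _ fun ω => ?_)
  refine tendsto_const_nhds.congr' ?_
  have : ∀ᶠ R : ℕ in atTop, ∀ k, |V ω k| ≤ R := by
    rw [eventually_all]
    exact fun k => tendsto_natCast_atTop_atTop.eventually_ge_atTop _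
  filter_upwards [this] with R hR
  simp [truncProd, hR]

/-- One cutoff is shared by all entries, so the truncated matrix is either `x xᵀ` or `0` and never
exceeds `x xᵀ` as a form. A lower bound for bounded variables thus passes to the untruncated ones.
-/
theorem sum_truncProd_le_sq (R : ℝ) (x v : κ → ℝ) :
    ∑ i, ∑ j, v i * v j * truncProd R i j x ≤ (∑ i, x i * v i) ^ 2 := by
  unfold truncProd
  split_ifs with h
  · refine le_of_eq ?_
    rw [sq, Finset.sum_mul_sum]
    exact Finset.sum_congr rfl fun i _ => Finset.sum_congr rfl fun j _ => by ring
  · simpa using sq_nonneg _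

/-- The smallest eigenvalue of the empirical second moment matrix of `m` i.i.d. square integrable
vectors is at least half that of the true one, up to a probability that is exponentially small
in `m`. -/
theorem exists_measureReal_not_coercive_le [IsProbabilityMeasure μ] {V : Ω → κ → ℝ}
    (hV : Measurable V) (hV2 : ∀ i, MemLp (fun ω => V ω i) 2 μ) {ζ : ℕ → Ω → κ → ℝ}
    (hind : iIndepFun ζ μ) (hdist : ∀ l, IdentDistrib (ζ l) V μ μ) {a : ℝ} (ha : 0 < a)
    (haV : ∀ v : κ → ℝ, a * ∑ i, v i ^ 2 ≤ v ⬝ᵥ secondMomentMatrix V μ *ᵥ v) :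
    ∃ r : ℝ, 0 < r ∧ ∀ m : ℕ, 0 < m →
      μ.real {ω | ¬ ∀ v : κ → ℝ,
        (a / 2 * m) * ∑ i, v i ^ 2 ≤ ∑ l : Fin m, (∑ i, ζ l ω i * v i) ^ 2} ≤
      (Fintype.card κ : ℝ) ^ 2 * (2 * Real.exp (-r * m)) := by
  set p : ℝ := (Fintype.card κ : ℝ) with hp
  have hp0 : 0 ≤ p := by positivity
  -- Truncation bias and sampling deviation each cost `δ` per entry, which moves the form by at most
  -- `2 δ p ‖v‖² ≤ (a / 2) ‖v‖²`. The `+ 1` covers an empty index type.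
  set δ : ℝ := a / (4 * (p + 1)) with hδ
  have hδ0 : 0 < δ := by positivity
  have hδp : 2 * (δ * p) ≤ a / 2 := by
    rw [hδ, div_mul_eq_mul_div, ← mul_div_assoc, div_le_iff₀ (by positivity)]
    nlinarith
  -- The level `R` is fixed before `m`, so the exponential rate does not depend on `m`.
  obtain ⟨R, hR, hR0⟩ : ∃ R : ℕ, (∀ i j, |∫ ω, truncProd R i j (V ω) ∂μ -
      ∫ ω, V ω i * V ω j ∂μ| ≤ δ) ∧ 0 < R := by
    refine Eventually.exists (f := atTop) (Eventually.and ?_ (eventually_gt_atTop 0))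
    simp_rw [eventually_all]
    intro i j
    filter_upwards [(tendsto_integral_truncProd hV hV2 i j).eventually
      (Metric.closedBall_mem_nhds _ hδ0)] with R h
    simpa [Real.dist_eq] using h
  refine ⟨δ ^ 2 / (2 * ((R : ℝ) ^ 2) ^ 2), by positivity, fun m hm => ?_⟩
  set E : κ × κ → Set Ω := fun ij => {ω | δ * m ≤ |∑ l : Fin m, truncProd R ij.1 ij.2 (ζ l ω) -
    m * ∫ ω, truncProd R ij.1 ij.2 (V ω) ∂μ|} with hE
  have hsub : {ω | ¬ ∀ v : κ → ℝ, (a / 2 * m) * ∑ i, v i ^ 2 ≤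
      ∑ l : Fin m, (∑ i, ζ l ω i * v i) ^ 2} ⊆ ⋃ ij, E ij := by
    intro ω hω
    by_contra hn
    refine hω fun v => ?_
    have hn' : ∀ i j, |∑ l : Fin m, truncProd R i j (ζ l ω) -
        m * ∫ ω, truncProd R i j (V ω) ∂μ| ≤ δ * m := by
      intro i j
      by_contra! h
      exact hn (Set.mem_iUnion.2 ⟨(i, j), h.le⟩)
    set B : κ → κ → ℝ := fun i j => ∑ l : Fin m, truncProd R i j (ζ l ω) -
      m * ∫ ω, V ω i * V ω j ∂μ with hB
    have hBle : ∀ i j, |B i j| ≤ 2 * (δ * m) := by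
      intro i j
      have e : B i j = (∑ l : Fin m, truncProd R i j (ζ l ω) -
          m * ∫ ω, truncProd R i j (V ω) ∂μ) + m * (∫ ω, truncProd R i j (V ω) ∂μ -
          ∫ ω, V ω i * V ω j ∂μ) := by
        rw [hB]; ring
      rw [e]
      refine (abs_add_le _ _).trans ?_
      have h2 : |(m : ℝ) * (∫ ω, truncProd R i j (V ω) ∂μ - ∫ ω, V ω i * V ω j ∂μ)| ≤ m * δ := by
        rw [abs_mul, Nat.abs_cast]
        exact mul_le_mul_of_nonneg_left (hR i j) (Nat.cast_nonneg _)
      linarith [hn' i j]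
    have h1 := (abs_le.1 (abs_sum_mul_le hBle v)).1
    have h2 := haV v
    have h3 : ∑ i, ∑ j, v i * v j * B i j = ∑ l : Fin m, ∑ i, ∑ j,
        v i * v j * truncProd R i j (ζ l ω) - m * (v ⬝ᵥ secondMomentMatrix V μ *ᵥ v) := by
      have e : ∑ l : Fin m, ∑ i, ∑ j, v i * v j * truncProd R i j (ζ l ω) =
          ∑ i, ∑ j, v i * v j * ∑ l : Fin m, truncProd R i j (ζ l ω) := by
        rw [Finset.sum_comm]
        refine Finset.sum_congr rfl fun i _ => ?_
        rw [Finset.sum_comm]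
        exact Finset.sum_congr rfl fun j _ => by rw [Finset.mul_sum]
      rw [e]
      simp only [hB, secondMomentMatrix, dotProduct, Matrix.mulVec, Matrix.of_apply]
      rw [Finset.mul_sum, ← Finset.sum_sub_distrib]
      refine Finset.sum_congr rfl fun i _ => ?_
      simp only [Finset.mul_sum Finset.univ _ (v i), Finset.mul_sum Finset.univ _ (m : ℝ),
        ← Finset.sum_sub_distrib]
      exact Finset.sum_congr rfl fun j _ => by ring
    have h4 : ∑ l : Fin m, ∑ i, ∑ j, v i * v j * truncProd R i j (ζ l ω) ≤
        ∑ l : Fin m, (∑ i, ζ l ω i * v i) ^ 2 :=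
      Finset.sum_le_sum fun l _ => sum_truncProd_le_sq _ _ _
    have h5 : 0 ≤ ∑ i, v i ^ 2 := Finset.sum_nonneg fun i _ => sq_nonneg _
    have h6 : (0 : ℝ) ≤ m := Nat.cast_nonneg _
    have h7 : (m : ℝ) * (a * ∑ i, v i ^ 2) ≤ m * (v ⬝ᵥ secondMomentMatrix V μ *ᵥ v) := by gcongr
    have h8 : 2 * (δ * m) * p * ∑ i, v i ^ 2 ≤ a / 2 * m * ∑ i, v i ^ 2 := by
      refine mul_le_mul_of_nonneg_right ?_ h5
      calc 2 * (δ * m) * p = 2 * (δ * p) * m := by ring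
        _ ≤ _ := by gcongr
    linarith
  calc _ ≤ μ.real (⋃ ij, E ij) := measureReal_mono hsub
    _ ≤ ∑ ij, μ.real (E ij) := measureReal_iUnion_fintype_le E
    _ ≤ ∑ _ij : κ × κ, 2 * Real.exp (-(δ ^ 2 / (2 * ((R : ℝ) ^ 2) ^ 2)) * m) :=
        Finset.sum_le_sum fun ij _ => measureReal_le_abs_empirical_sub_le hind hdist
          (measurable_truncProd _ _ _) (abs_truncProd_le _ _ _) hm hδ0.le
    _ = _ := by
        rw [Finset.sum_const, Finset.card_univ, Fintype.card_prod, nsmul_eq_mul]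
        push_cast
        ring

end DesignMatrix

/-! ### Conditional risk with frozen coefficients -/

section CondRisk

variable {Ω : Type*} [MeasurableSpace Ω] {μ : Measure Ω}

/-- The conditional expectation given `b` of a function of `b` and of an independent `w` is obtained
by integrating over `w` with `b` frozen. -/
theorem condLExp_comp_of_indepFun [IsProbabilityMeasure μ] {𝓑 𝓦 : Type*} [mB : MeasurableSpace 𝓑]
    [MeasurableSpace 𝓦] {b : Ω → 𝓑} (hb : Measurable b) {w : Ω → 𝓦} (hw : Measurable w)
    (hbw : IndepFun b w μ) {F : 𝓑 × 𝓦 → ℝ≥0∞} (hF : Measurable F) :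
    condLExp (mB.comap b) μ (fun ω => F (b ω, w ω)) =ᵐ[μ]
      fun ω => ∫⁻ ω', F (b ω, w ω') ∂μ := by
  have := Measure.isProbabilityMeasure_map hb.aemeasurable (μ := μ)
  have := Measure.isProbabilityMeasure_map hw.aemeasurable (μ := μ)
  have hG : Measurable fun x : 𝓑 => ∫⁻ y, F (x, y) ∂(μ.map w) := hF.lintegral_prod_right'
  have hfr : ∀ x, ∫⁻ ω', F (x, w ω') ∂μ = ∫⁻ y, F (x, y) ∂(μ.map w) := fun x =>
    (lintegral_map (hF.comp measurable_prodMk_left) hw).symm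
  simp_rw [hfr]
  -- It suffices to compare integrals over the sets `b ⁻¹' s`. The indicator of such a set is
  -- absorbed into `F`, and Tonelli applies to the product law of `(b, w)`.
  refine (ae_eq_condLExp hb.comap_le μ _ (hG.comp (comap_measurable b)) ?_).symm
  rintro _ ⟨s, hs, rfl⟩
  rw [← lintegral_indicator (hb hs), ← lintegral_indicator (hb hs)]
  have h1 : ∀ ω, (b ⁻¹' s).indicator (fun ω => ∫⁻ y, F (b ω, y) ∂(μ.map w)) ω =
      ∫⁻ y, (s ×ˢ (Set.univ : Set 𝓦)).indicator F (b ω, y) ∂(μ.map w) := by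
    intro ω
    by_cases h : b ω ∈ s
    · simp [h]
    · simp [h]
  have h2 : ∀ ω, (b ⁻¹' s).indicator (fun ω => F (b ω, w ω)) ω =
      (s ×ˢ (Set.univ : Set 𝓦)).indicator F (b ω, w ω) := by
    intro ω
    by_cases h : b ω ∈ s
    · simp [h]
    · simp [h]
  have hF' : Measurable ((s ×ˢ (Set.univ : Set 𝓦)).indicator F) :=
    hF.indicator (hs.prod .univ)
  simp only [Function.comp_def, h1, h2]
  rw [← lintegral_map (g := b) (f := fun x => ∫⁻ y, (s ×ˢ (Set.univ : Set 𝓦)).indicator F (x, y)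
      ∂(μ.map w)) hF'.lintegral_prod_right' hb,
    ← lintegral_map (g := fun ω => (b ω, w ω)) hF' (hb.prodMk hw),
    (indepFun_iff_map_prod_eq_prod_map_map hb.aemeasurable hw.aemeasurable).1 hbw,
    lintegral_prod _ hF'.aemeasurable]

variable {κ : Type*} [Fintype κ]

theorem memLp_dotProduct {V : Ω → κ → ℝ} (hV2 : ∀ i, MemLp (fun ω => V ω i) 2 μ) (u : κ → ℝ) :
    MemLp (fun ω => u ⬝ᵥ V ω) 2 μ :=
  memLp_finsetSum _ fun i _ => (hV2 i).const_mul (u i)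

theorem dotProduct_secondMomentMatrix_mulVec {V : Ω → κ → ℝ}
    (hV2 : ∀ i, MemLp (fun ω => V ω i) 2 μ) (u : κ → ℝ) :
    u ⬝ᵥ secondMomentMatrix V μ *ᵥ u = ∫ ω, (u ⬝ᵥ V ω) ^ 2 ∂μ := by
  have h : ∀ ω, (u ⬝ᵥ V ω) ^ 2 = ∑ i, ∑ j, u i * u j * (V ω i * V ω j) := by
    intro ω
    rw [sq, dotProduct, Finset.sum_mul_sum]
    exact Finset.sum_congr rfl fun i _ => Finset.sum_congr rfl fun j _ => by ring
  have hi : ∀ i j, Integrable (fun ω => u i * u j * (V ω i * V ω j)) μ := fun i j =>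
    ((hV2 i).integrable_mul (hV2 j)).const_mul _
  simp_rw [h]
  rw [integral_finsetSum _ fun i _ => integrable_finsetSum _ fun j _ => hi i j]
  simp only [dotProduct, Matrix.mulVec, secondMomentMatrix, Matrix.of_apply]
  refine Finset.sum_congr rfl fun i _ => ?_
  rw [integral_finsetSum _ fun j _ => hi i j, Finset.mul_sum]
  refine Finset.sum_congr rfl fun j _ => ?_
  rw [integral_const_mul]
  ring

theorem posSemidef_secondMomentMatrix {V : Ω → κ → ℝ}
    (hV2 : ∀ i, MemLp (fun ω => V ω i) 2 μ) : (secondMomentMatrix V μ).PosSemidef := by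
  refine Matrix.PosSemidef.of_dotProduct_mulVec_nonneg ?_ fun u => ?_
  · ext i j
    simp [secondMomentMatrix, mul_comm]
  · rw [star_trivial, dotProduct_secondMomentMatrix_mulVec hV2]
    exact integral_nonneg fun ω => sq_nonneg _

theorem variance_dotProduct [IsProbabilityMeasure μ] {V : Ω → κ → ℝ}
    (hV2 : ∀ i, MemLp (fun ω => V ω i) 2 μ) (u : κ → ℝ) :
    Var[fun ω => u ⬝ᵥ V ω; μ] = u ⬝ᵥ covMatrix V μ *ᵥ u := by
  simp only [dotProduct]
  rw [variance_fun_sum fun i => (hV2 i).const_mul (u i)]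
  simp only [covMatrix, Matrix.mulVec, Matrix.of_apply, dotProduct, covariance_const_mul_left,
    covariance_const_mul_right, Finset.mul_sum]
  exact Finset.sum_congr rfl fun i _ => Finset.sum_congr rfl fun j _ => by ring

theorem integral_dotProduct [IsProbabilityMeasure μ] {V : Ω → κ → ℝ}
    (hV2 : ∀ i, MemLp (fun ω => V ω i) 2 μ) (u : κ → ℝ) :
    ∫ ω, u ⬝ᵥ V ω ∂μ = u ⬝ᵥ meanVec V μ := by
  simp only [dotProduct, meanVec]
  rw [integral_finsetSum _ fun i _ => ((hV2 i).integrable one_le_two).const_mul (u i)]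
  exact Finset.sum_congr rfl fun i _ => integral_const_mul _ _

/-- Mean squared error of the empirical mean of `a ⬝ᵥ V` as an estimate of `𝔼[α ⬝ᵥ V]`. -/
theorem lintegral_sq_empirical_sub_le [IsProbabilityMeasure μ] {V : Ω → κ → ℝ}
    (hV2 : ∀ i, MemLp (fun ω => V ω i) 2 μ) {W : ℕ → Ω → κ → ℝ}
    (hind : iIndepFun W μ) (hdist : ∀ l, IdentDistrib (W l) V μ μ) (a α : κ → ℝ)
    {N : ℕ} (hN : 1 ≤ N) :
    ∫⁻ ω, ENNReal.ofReal (((N : ℝ)⁻¹ * ∑ l ∈ Finset.range N, a ⬝ᵥ W l ω - α ⬝ᵥ meanVec V μ) ^ 2) ∂μ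
      ≤ ENNReal.ofReal (2 * (1 / N * (α ⬝ᵥ covMatrix V μ *ᵥ α)) +
        2 * ((a - α) ⬝ᵥ secondMomentMatrix V μ *ᵥ (a - α))) := by
  have hN0 : (0 : ℝ) < N := by exact_mod_cast hN
  have hdot : ∀ u : κ → ℝ, Measurable fun x : κ → ℝ => u ⬝ᵥ x := by
    intro u
    simp only [dotProduct]
    fun_prop
  have hid : ∀ u l, IdentDistrib (fun ω => u ⬝ᵥ W l ω) (fun ω => u ⬝ᵥ V ω) μ μ := fun u l =>
    (hdist l).comp (hdot u)
  have hL : ∀ u l, MemLp (fun ω => u ⬝ᵥ W l ω) 2 μ := fun u l =>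
    (hid u l).memLp_iff.2 (memLp_dotProduct hV2 u)
  -- The error is `S₁ - 𝔼 S₁`, with the true coefficients, plus `S₂`, which carries the coefficient
  -- error `a - α`.
  set S₁ : Ω → ℝ := fun ω => (N : ℝ)⁻¹ * ∑ l ∈ Finset.range N, α ⬝ᵥ W l ω with hS₁
  have hS₁L : MemLp S₁ 2 μ := (memLp_finsetSum _ fun l _ => hL α l).const_mul _
  have hS₁m : ∫ ω, S₁ ω ∂μ = α ⬝ᵥ meanVec V μ := by
    rw [hS₁, integral_const_mul, integral_finsetSum _ fun l _ => (hL α l).integrable one_le_two]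
    simp_rw [fun l => (hid α l).integral_eq, integral_dotProduct hV2]
    simp [hN0.ne']
  have hS₁v : ∫ ω, (S₁ ω - α ⬝ᵥ meanVec V μ) ^ 2 ∂μ = 1 / N * (α ⬝ᵥ covMatrix V μ *ᵥ α) := by
    rw [← hS₁m, ← variance_eq_integral hS₁L.aestronglyMeasurable.aemeasurable, hS₁,
      variance_const_mul]
    have : Var[fun ω => ∑ l ∈ Finset.range N, α ⬝ᵥ W l ω; μ] =
        ∑ l ∈ Finset.range N, Var[fun ω => α ⬝ᵥ W l ω; μ] := by
      have h := IndepFun.variance_sum (s := Finset.range N) (X := fun l ω => α ⬝ᵥ W l ω) (μ := μ)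
        (fun l _ => hL α l) fun i _ j _ hij => (hind.indepFun hij).comp (hdot α) (hdot α)
      rw [← h]
      congr 1
      ext ω
      simp
    rw [this]
    simp_rw [fun l => (hid α l).variance_eq, variance_dotProduct hV2]
    simp only [Finset.sum_const, Finset.card_range, nsmul_eq_mul]
    field_simp
  set S₂ : Ω → ℝ := fun ω => (N : ℝ)⁻¹ * ∑ l ∈ Finset.range N, (a - α) ⬝ᵥ W l ω with hS₂
  have hS₂L : MemLp S₂ 2 μ := (memLp_finsetSum _ fun l _ => hL _ l).const_mul _
  -- The mean of `S₂` does not decay with `N`, so no variance reduction is sought: Cauchy–Schwarz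
  -- reduces to the second moment of one sample.
  have hS₂v : ∫ ω, S₂ ω ^ 2 ∂μ ≤ (a - α) ⬝ᵥ secondMomentMatrix V μ *ᵥ (a - α) := by
    calc ∫ ω, S₂ ω ^ 2 ∂μ
        ≤ ∫ ω, (N : ℝ)⁻¹ * ∑ l ∈ Finset.range N, ((a - α) ⬝ᵥ W l ω) ^ 2 ∂μ := by
          refine integral_mono hS₂L.integrable_sq
            ((integrable_finsetSum _ fun l _ => (hL _ l).integrable_sq).const_mul _) fun ω => ?_
          simp only [hS₂, mul_pow]
          have h := sq_sum_le_card_mul_sum_sq (s := Finset.range N)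
            (f := fun l => (a - α) ⬝ᵥ W l ω)
          rw [Finset.card_range] at h
          calc _ ≤ ((N : ℝ)⁻¹) ^ 2 * (N * ∑ l ∈ Finset.range N, ((a - α) ⬝ᵥ W l ω) ^ 2) := by
                gcongr
            _ = _ := by field_simp
      _ = _ := by
          rw [integral_const_mul, integral_finsetSum _ fun l _ => (hL _ l).integrable_sq]
          have : ∀ l, ∫ ω, ((a - α) ⬝ᵥ W l ω) ^ 2 ∂μ =
              (a - α) ⬝ᵥ secondMomentMatrix V μ *ᵥ (a - α) := fun l => by
            rw [dotProduct_secondMomentMatrix_mulVec hV2]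
            exact ((hid (a - α) l).comp (measurable_id.pow_const 2)).integral_eq
          simp_rw [this]
          simp only [Finset.sum_const, Finset.card_range, nsmul_eq_mul]
          field_simp
  have hi₁ : Integrable (fun ω => (S₁ ω - α ⬝ᵥ meanVec V μ) ^ 2) μ :=
    (hS₁L.sub (memLp_const _)).integrable_sq
  have hi₂ : Integrable (fun ω => S₂ ω ^ 2) μ := hS₂L.integrable_sq
  have hi : Integrable (fun ω => 2 * (S₁ ω - α ⬝ᵥ meanVec V μ) ^ 2 + 2 * S₂ ω ^ 2) μ :=
    (hi₁.const_mul 2).add (hi₂.const_mul 2)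
  calc _ ≤ ∫⁻ ω, ENNReal.ofReal (2 * (S₁ ω - α ⬝ᵥ meanVec V μ) ^ 2 + 2 * S₂ ω ^ 2) ∂μ := by
        refine lintegral_mono fun ω => ENNReal.ofReal_le_ofReal ?_
        have : (N : ℝ)⁻¹ * ∑ l ∈ Finset.range N, a ⬝ᵥ W l ω - α ⬝ᵥ meanVec V μ =
            (S₁ ω - α ⬝ᵥ meanVec V μ) + S₂ ω := by
          simp only [hS₁, hS₂, sub_dotProduct, Finset.sum_sub_distrib]
          ring
        rw [this]
        nlinarith [sq_nonneg (S₁ ω - α ⬝ᵥ meanVec V μ - S₂ ω)]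
    _ = ENNReal.ofReal (∫ ω, (2 * (S₁ ω - α ⬝ᵥ meanVec V μ) ^ 2 + 2 * S₂ ω ^ 2) ∂μ) := by
        rw [ofReal_integral_eq_lintegral_ofReal hi (ae_of_all _ fun ω => by positivity)]
    _ ≤ _ := by
        refine ENNReal.ofReal_le_ofReal ?_
        rw [integral_add (hi₁.const_mul 2) (hi₂.const_mul 2), integral_const_mul,
          integral_const_mul, hS₁v]
        linarith

/-- This splits the vector risk into scalar problems, one for each row of `Q * β`. -/
theorem trace_covMatrix_mul {k q : ℕ} (V : Ω → κ → ℝ) (Q : Matrix (Fin q) (Fin k) ℝ)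
    (β : Matrix (Fin k) κ ℝ) : (covMatrix V μ * βᵀ * Qᵀ * Q * β).trace =
      ∑ r, (Q * β) r ⬝ᵥ covMatrix V μ *ᵥ (Q * β) r := by
  have : covMatrix V μ * βᵀ * Qᵀ * Q * β = covMatrix V μ * (Q * β)ᵀ * (Q * β) := by
    rw [Matrix.transpose_mul]; simp only [Matrix.mul_assoc]
  rw [this, Matrix.trace_mul_comm]
  rfl

/-- Risk of the regression Monte Carlo estimator with a deterministic coefficient matrix. -/
theorem lintegral_sq_norm_lrmc_le [IsProbabilityMeasure μ] {k q : ℕ} {V : Ω → κ → ℝ}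
    (hV2 : ∀ i, MemLp (fun ω => V ω i) 2 μ) {W : ℕ → Ω → κ → ℝ} (hW : ∀ l, Measurable (W l))
    (hind : iIndepFun W μ) (hdist : ∀ l, IdentDistrib (W l) V μ μ)
    (Q : Matrix (Fin q) (Fin k) ℝ) (b β : Matrix (Fin k) κ ℝ) {N : ℕ} (hN : 1 ≤ N) :
    ∫⁻ ω, ENNReal.ofReal
        (‖WithLp.toLp 2 (Q *ᵥ (lrmc N b (fun l => W l ω) - β *ᵥ meanVec V μ))‖ ^ 2) ∂μ ≤
      ENNReal.ofReal (2 * (1 / N * (covMatrix V μ * βᵀ * Qᵀ * Q * β).trace) +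
        2 * ∑ r, (Q * (b - β)) r ⬝ᵥ secondMomentMatrix V μ *ᵥ (Q * (b - β)) r) := by
  have hrow : ∀ ω, ‖WithLp.toLp 2 (Q *ᵥ (lrmc N b (fun l => W l ω) - β *ᵥ meanVec V μ))‖ ^ 2 =
      ∑ r, ((N : ℝ)⁻¹ * ∑ l ∈ Finset.range N, (Q * b) r ⬝ᵥ W l ω -
        (Q * β) r ⬝ᵥ meanVec V μ) ^ 2 := by
    intro ω
    rw [EuclideanSpace.norm_sq_eq]
    refine Finset.sum_congr rfl fun r _ => ?_
    rw [Real.norm_eq_abs, sq_abs]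
    congr 1
    change (Q *ᵥ (lrmc N b (fun l => W l ω) - β *ᵥ meanVec V μ)) r = _
    rw [Matrix.mulVec_sub, Matrix.mulVec_mulVec, Pi.sub_apply]
    congr 1
    rw [lrmc, Matrix.mulVec_smul, Matrix.mulVec_sum, Pi.smul_apply, Finset.sum_apply,
      smul_eq_mul]
    simp_rw [Matrix.mulVec_mulVec]
    rfl
  have hdot : ∀ u : κ → ℝ, Measurable fun x : κ → ℝ => u ⬝ᵥ x := by
    intro u
    simp only [dotProduct]
    fun_prop
  have htr := trace_covMatrix_mul (μ := μ) V Q β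
  have hnn₁ : ∀ r, 0 ≤ (Q * β) r ⬝ᵥ covMatrix V μ *ᵥ (Q * β) r := fun r => by
    rw [← variance_dotProduct hV2]; exact variance_nonneg _ _
  have hnn₂ : ∀ r, 0 ≤ (Q * (b - β)) r ⬝ᵥ secondMomentMatrix V μ *ᵥ (Q * (b - β)) r := fun r => by
    rw [dotProduct_secondMomentMatrix_mulVec hV2]; exact integral_nonneg fun ω => sq_nonneg _
  calc _ = ∫⁻ ω, ∑ r, ENNReal.ofReal (((N : ℝ)⁻¹ * ∑ l ∈ Finset.range N, (Q * b) r ⬝ᵥ W l ω -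
        (Q * β) r ⬝ᵥ meanVec V μ) ^ 2) ∂μ := by
        refine lintegral_congr fun ω => ?_
        rw [hrow, ENNReal.ofReal_sum_of_nonneg fun r _ => sq_nonneg _]
    _ = ∑ r, ∫⁻ ω, ENNReal.ofReal (((N : ℝ)⁻¹ * ∑ l ∈ Finset.range N, (Q * b) r ⬝ᵥ W l ω -
        (Q * β) r ⬝ᵥ meanVec V μ) ^ 2) ∂μ := by
        refine lintegral_finsetSum _ fun r _ => ?_
        have : ∀ l, Measurable fun ω => (Q * b) r ⬝ᵥ W l ω := fun l => (hdot _).comp (hW l)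
        fun_prop
    _ ≤ ∑ r, ENNReal.ofReal (2 * (1 / N * ((Q * β) r ⬝ᵥ covMatrix V μ *ᵥ (Q * β) r)) +
        2 * ((Q * (b - β)) r ⬝ᵥ secondMomentMatrix V μ *ᵥ (Q * (b - β)) r)) := by
        refine Finset.sum_le_sum fun r _ => ?_
        have h := lintegral_sq_empirical_sub_le hV2 hind hdist ((Q * b) r) ((Q * β) r) hN
        have e : (Q * b) r - (Q * β) r = (Q * (b - β)) r := by
          rw [Matrix.mul_sub]; rfl
        rwa [e] at h
    _ = _ := by
        rw [← ENNReal.ofReal_sum_of_nonneg fun r _ => by have := hnn₁ r; have := hnn₂ r; positivity,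
          Finset.sum_add_distrib, htr]
        simp only [Finset.mul_sum]

end CondRisk

/-! ### Measurability and error formula of least squares -/

section LeastSquares

variable {n k q : ℕ} (S : Finset (Fin n))

theorem measurable_regressor : Measurable (regressor S) := by
  refine measurable_pi_lambda _ fun i => ?_
  cases i with
  | none => exact measurable_const
  | some i => exact measurable_pi_apply _

theorem measurable_pinv_designMatrix (m : ℕ) :
    Measurable fun (x : Fin m → Option S → ℝ) (i : Option S) (l : Fin m) =>
      pinv (Matrix.of x) i l :=
  measurable_pinv

theorem measurable_lsCoef (m : ℕ) :
    Measurable fun (d : ℕ → (Fin n → ℝ) × (Fin k → ℝ)) (j : Fin k) (i : Option S) =>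
      lsCoef S m d j i := by
  have hZ : Measurable fun (d : ℕ → (Fin n → ℝ) × (Fin k → ℝ)) (l : Fin m) =>
      regressor S (d l).1 := by
    refine measurable_pi_lambda _ fun l => (measurable_regressor S).comp ?_
    fun_prop
  have hP := (measurable_pinv_designMatrix S m).comp hZ
  refine measurable_pi_lambda _ fun j => measurable_pi_lambda _ fun i => ?_
  simp only [lsCoef, Matrix.transpose_apply, Matrix.mul_apply]
  refine Finset.measurable_fun_sum _ fun l _ => Measurable.mul ?_ ?_
  · exact (measurable_pi_apply l).comp ((measurable_pi_apply i).comp hP)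
  · simp only [responseMatrix, Matrix.of_apply]
    fun_prop

/-- The estimation error of least squares is linear in the residuals. -/
theorem mul_lsCoef_sub_apply {m : ℕ} (d : ℕ → (Fin n → ℝ) × (Fin k → ℝ))
    (β : Matrix (Fin k) (Option S) ℝ) (Q : Matrix (Fin q) (Fin k) ℝ)
    (hZ : pinv (designMatrix S m fun l => (d l).1) * (designMatrix S m fun l => (d l).1) = 1)
    (r : Fin q) (i : Option S) :
    (Q * (lsCoef S m d - β)) r i = ∑ l : Fin m,
      pinv (designMatrix S m fun l => (d l).1) i l *
        (Q *ᵥ ((d l).2 - β *ᵥ regressor S (d l).1)) r := by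
  set Z := designMatrix S m fun l => (d l).1 with hZdef
  -- Residuals are defined for arbitrary data, so the identity is deterministic; the linear model
  -- enters only through their law.
  set E : Matrix (Fin m) (Fin k) ℝ :=
    Matrix.of fun l : Fin m => (d l).2 - β *ᵥ regressor S (d l).1 with hE
  have hY : (responseMatrix m fun l => (d l).2) = Z * βᵀ + E := by
    ext l j
    simp only [responseMatrix, hE, hZdef, designMatrix, Matrix.of_apply, Matrix.add_apply,
      Matrix.mul_apply, Matrix.transpose_apply, Pi.sub_apply, Matrix.mulVec, dotProduct]
    simp [mul_comm]
  have h : lsCoef S m d - β = (pinv Z * E)ᵀ := by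
    rw [lsCoef, ← hZdef, hY, Matrix.mul_add, ← Matrix.mul_assoc, hZ, Matrix.one_mul,
      Matrix.transpose_add, Matrix.transpose_transpose, add_sub_cancel_left]
  have h2 : (Q * (pinv Z * E)ᵀ) = (pinv Z * (E * Qᵀ))ᵀ := by
    simp [Matrix.transpose_mul, Matrix.mul_assoc]
  rw [h, h2, Matrix.transpose_apply, Matrix.mul_apply]
  refine Finset.sum_congr rfl fun l _ => ?_
  congr 1
  simp [hE, Matrix.mul_apply, Matrix.mulVec, dotProduct, mul_comm]

end LeastSquares

/-! ### Noise in the coefficient estimate -/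

section Noise

variable {Ω : Type*} [MeasurableSpace Ω] {μ : Measure Ω} {k q : ℕ} {ε : Ω → Fin k → ℝ}

/-- The definition tests unit vectors only, while the rows of `Q` are arbitrary; scaling by `‖u‖`
bridges this. -/
theorem IsSubGaussianVector.exists_dotProduct [IsProbabilityMeasure μ]
    (h : IsSubGaussianVector ε μ) :
    ∀ u : Fin k → ℝ, ∃ c : ℝ≥0, HasSubgaussianMGF (fun ω => u ⬝ᵥ ε ω) c μ := by
  obtain ⟨c, hc⟩ := h
  intro u
  rcases eq_or_ne u 0 with rfl | hu
  · exact ⟨0, by simp⟩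
  set U : EuclideanSpace ℝ (Fin k) := WithLp.toLp 2 u
  have hU : ‖U‖ ≠ 0 := by
    rw [norm_ne_zero_iff]
    intro h
    exact hu (by simpa [U] using congrArg WithLp.ofLp h)
  refine ⟨_, ((hc (‖U‖⁻¹ • U) (by simp [norm_smul, hU])).const_mul ‖U‖).congr
    (ae_of_all _ fun ω => ?_)⟩
  simp only [PiLp.smul_apply, smul_eq_mul, dotProduct, Finset.mul_sum]
  refine Finset.sum_congr rfl fun j _ => ?_
  rw [← mul_assoc, mul_inv_cancel_left₀ hU]

theorem IsSubGaussianVector.exists_apply [IsProbabilityMeasure μ]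
    (h : IsSubGaussianVector ε μ) (j : Fin k) :
    ∃ c : ℝ≥0, HasSubgaussianMGF (fun ω => ε ω j) c μ := by
  obtain ⟨c, hc⟩ := h.exists_dotProduct (Pi.single j 1)
  exact ⟨c, by simpa using hc⟩

theorem IsSubGaussianVector.memLp [IsProbabilityMeasure μ]
    (h : IsSubGaussianVector ε μ) (j : Fin k) : MemLp (fun ω => ε ω j) 2 μ := by
  obtain ⟨c, hc⟩ := h.exists_apply j
  exact hc.memLp 2

theorem trace_covMatrix_eq_sum_variance [IsProbabilityMeasure μ]
    (hε2 : ∀ j, MemLp (fun ω => ε ω j) 2 μ) (Q : Matrix (Fin q) (Fin k) ℝ) :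
    (Q * covMatrix ε μ * Qᵀ).trace = ∑ r, Var[fun ω => (Q *ᵥ ε ω) r; μ] := by
  refine Finset.sum_congr rfl fun r _ => ?_
  change _ = Var[fun ω => Q r ⬝ᵥ ε ω; μ]
  rw [variance_dotProduct hε2, Matrix.diag_apply, Matrix.mul_assoc]
  simp only [Matrix.mul_apply, Matrix.transpose_apply, dotProduct, Matrix.mulVec]

/-- With probability at least `1 - 2 m⁻³`, a combination of `m` noise samples with weights of squared
length at most `b / m`, depending on independent covariates, has square of order `log m / m` times
the variance of the noise. -/
theorem exists_measureReal_lt_sq_sum_le [IsProbabilityMeasure μ] (hε : Measurable ε)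
    (hsub : IsSubGaussianVector ε μ) (Q : Matrix (Fin q) (Fin k) ℝ)
    {𝓥 : Type*} [MeasurableSpace 𝓥] {V : Ω → 𝓥} (hV : Measurable V) (hVε : IndepFun V ε μ)
    {ζ : ℕ → Ω → 𝓥 × (Fin k → ℝ)} (hζ : ∀ l, Measurable (ζ l)) (hind : iIndepFun ζ μ)
    (hdist : ∀ l, IdentDistrib (ζ l) (fun ω => (V ω, ε ω)) μ μ) {b : ℝ} (hb : 0 < b) :
    ∃ A : ℝ, 0 < A ∧ ∀ m : ℕ, 0 < m → ∀ g : (Fin m → 𝓥) → Fin m → ℝ, Measurable g →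
      ∀ r, μ.real {ω | ∑ l, g (fun l => (ζ l ω).1) l ^ 2 ≤ b / m ∧
        A * (Q * covMatrix ε μ * Qᵀ).trace * (Real.log m / m) <
          (∑ l : Fin m, g (fun l => (ζ l ω).1) l * (Q *ᵥ (ζ l ω).2) r) ^ 2} ≤
      2 / (m : ℝ) ^ 3 := by
  have hQm : ∀ r, Measurable fun x : Fin k → ℝ => (Q *ᵥ x) r := by
    intro r
    simp only [Matrix.mulVec, dotProduct]
    fun_prop
  set γ := (Q * covMatrix ε μ * Qᵀ).trace with hγ
  have hγs := trace_covMatrix_eq_sum_variance hsub.memLp Q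
  have hγ0 : 0 ≤ γ := by rw [hγ, hγs]; exact Finset.sum_nonneg fun r _ => variance_nonneg _ _
  choose c hc using fun r => hsub.exists_dotProduct (Q r)
  -- If `γ = 0`, every coordinate of `Q ε` is centered with variance zero, so it vanishes almost
  -- surely and the event is null.
  rcases hγ0.eq_or_lt with h0 | hpos
  · refine ⟨1, one_pos, fun m _ g _ r => ?_⟩
    have hz : ∀ᵐ ω ∂μ, (Q *ᵥ ε ω) r = 0 := by
      have hv : Var[fun ω => (Q *ᵥ ε ω) r; μ] = 0 :=
        (Finset.sum_eq_zero_iff_of_nonneg fun r _ => variance_nonneg _ _).1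
          (hγs.symm.trans h0.symm) r (Finset.mem_univ r)
      have h := ae_eq_integral_of_variance_eq_zero (((hc r).memLp 2)) hv
      have hm : ∫ ω, (Q *ᵥ ε ω) r ∂μ = 0 := integral_eq_zero_of_hasSubgaussianMGF (hc r)
      filter_upwards [h] with ω hω
      exact hω.trans hm
    have hzl : ∀ l, ∀ᵐ ω ∂μ, (Q *ᵥ (ζ l ω).2) r = 0 := fun l =>
      (hdist l).symm.ae_snd (p := fun x => (Q *ᵥ x.2) r = 0)
        ((hQm r).comp measurable_snd (measurableSet_singleton 0)) hz
    have hall : ∀ᵐ ω ∂μ, ∀ l, (Q *ᵥ (ζ l ω).2) r = 0 := ae_all_iff.2 hzl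
    have : μ {ω | ∑ l, g (fun l => (ζ l ω).1) l ^ 2 ≤ b / m ∧
        1 * γ * (Real.log m / m) <
          (∑ l : Fin m, g (fun l => (ζ l ω).1) l * (Q *ᵥ (ζ l ω).2) r) ^ 2} = 0 := by
      refine measure_mono_null (fun ω hω => ?_) hall
      intro (hn : ∀ l, (Q *ᵥ (ζ l ω).2) r = 0)
      have := hω.2
      simp [hn, ← h0] at this
    rw [measureReal_def, this]
    simp only [ENNReal.toReal_zero]
    positivity
  · set c' : ℝ≥0 := 1 + ∑ r, c r with hc'
    have hc0 : (0 : ℝ) < c' := by rw [hc']; positivity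
    -- With variance proxy `b c' / m`, the squared threshold `6 b c' log m / m` makes the exponent
    -- `-3 log m`. Dividing by `γ` writes this threshold as a multiple of the trace.
    refine ⟨6 * b * c' / γ, by positivity, fun m hm g hg r => ?_⟩
    have hm0 : (0 : ℝ) < m := by exact_mod_cast hm
    have hlog : 0 ≤ Real.log m := Real.log_nonneg (by exact_mod_cast hm)
    set T := 6 * b * c' / γ * γ * (Real.log m / m) with hT
    have hT0 : 0 ≤ T := by positivity
    have hcr : c r ≤ c' :=
      (Finset.single_le_sum (fun r _ => zero_le) (Finset.mem_univ r)).trans le_add_self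
    have hηm : Measurable fun ω => (Q *ᵥ ε ω) r := (hQm r).comp hε
    have hpair : Measurable fun x : 𝓥 × (Fin k → ℝ) => (x.1, (Q *ᵥ x.2) r) :=
      measurable_fst.prodMk ((hQm r).comp measurable_snd)
    have key := measureReal_le_abs_sum_random_weights_le (ι := Fin m) hV hηm
      (hVε.comp measurable_id (hQm r)) (hasSubgaussianMGF_mono (hc r) hcr)
      (ζ := fun l ω => ((ζ l ω).1, (Q *ᵥ (ζ l ω).2) r)) (fun l => hpair.comp (hζ l))
      ((hind.precomp Fin.val_injective).comp (fun _ x => (x.1, (Q *ᵥ x.2) r)) fun _ => hpair)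
      (fun l => (hdist l).comp hpair) hg (Real.toNNReal (b / m)) (Real.sqrt_nonneg T)
    rw [Real.coe_toNNReal _ (by positivity)] at key
    refine (measureReal_mono ?_).trans (key.trans (le_of_eq ?_))
    · exact fun ω hω => ⟨hω.1, (Real.sqrt_le_sqrt hω.2.le).trans_eq (Real.sqrt_sq_eq_abs _)⟩
    · rw [Real.sq_sqrt hT0]
      have : -T / (2 * (b / m * c')) = -(3 * Real.log m) := by
        rw [hT]; field_simp; ring
      rw [this, Real.exp_neg, show 3 * Real.log m = ((3 : ℕ) : ℝ) * Real.log m by norm_num,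
        Real.exp_nat_mul, Real.exp_log hm0]
      rfl

end Noise

/-! ### Moments, means and the final failure probability -/

theorem memLp_two_of_iSup_eLpNorm_le {Ω κ : Type*} [MeasurableSpace Ω] {μ : Measure Ω}
    [IsProbabilityMeasure μ] [Fintype κ] [DecidableEq κ] {V : Ω → κ → ℝ} (hV : Measurable V)
    {K : ℝ} (h : (⨆ (θ : EuclideanSpace ℝ κ) (_ : ‖θ‖ = 1),
      eLpNorm (fun ω => ∑ i, θ i * V ω i) 4 μ) ≤ ENNReal.ofReal K) (i : κ) :
    MemLp (fun ω => V ω i) 2 μ := by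
  have h1 := (iSup₂_le_iff.1 h) (EuclideanSpace.single i 1) (by simp)
  have e : (fun ω => ∑ j, (EuclideanSpace.single i (1 : ℝ)) j * V ω j) = fun ω => V ω i := by
    ext ω
    simp
  rw [e] at h1
  have hm : MemLp (fun ω => V ω i) 4 μ :=
    ⟨((measurable_pi_apply i).comp hV).aestronglyMeasurable, h1.trans_lt ENNReal.ofReal_lt_top⟩
  exact hm.mono_exponent (by norm_num)

theorem meanVec_linear_model {Ω κ : Type*} [MeasurableSpace Ω] {μ : Measure Ω}
    [IsProbabilityMeasure μ] [Fintype κ] {k : ℕ} {V : Ω → κ → ℝ}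
    (hV2 : ∀ i, MemLp (fun ω => V ω i) 2 μ) {fY ε : Ω → Fin k → ℝ} {β : Matrix (Fin k) κ ℝ}
    (hmodel : ∀ᵐ ω ∂μ, fY ω = β *ᵥ V ω + ε ω) (hsub : IsSubGaussianVector ε μ) :
    meanVec fY μ = β *ᵥ meanVec V μ := by
  ext j
  obtain ⟨c, hc⟩ := hsub.exists_apply j
  calc ∫ ω, fY ω j ∂μ = ∫ ω, (β j ⬝ᵥ V ω + ε ω j) ∂μ := by
        refine integral_congr_ae ?_
        filter_upwards [hmodel] with ω hω
        rw [hω]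
        rfl
    _ = _ := by
        rw [integral_add ((memLp_dotProduct hV2 _).integrable one_le_two) hc.integrable,
          integral_dotProduct hV2, integral_eq_zero_of_hasSubgaussianMGF hc, add_zero]
        rfl

theorem measurable_lrmc {k : ℕ} {κ : Type*} [Fintype κ] (N : ℕ) :
    Measurable fun p : (Fin k → κ → ℝ) × (ℕ → κ → ℝ) => lrmc N (Matrix.of p.1) p.2 := by
  refine measurable_pi_lambda _ fun j => ?_
  simp only [lrmc, Pi.smul_apply, Finset.sum_apply, Matrix.mulVec, dotProduct, Matrix.of_apply]
  fun_prop

/-- Both terms are `o(m⁻²)`; this fixes `m₀` and is why the noise tail is taken of order `m⁻³`. -/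
theorem eventually_failure_prob_le (a b : ℝ) {r : ℝ} (hr : 0 < r) :
    ∀ᶠ m : ℕ in atTop, a * (2 * Real.exp (-r * m)) + b * (2 / (m : ℝ) ^ 3) ≤ 1 / (m : ℝ) ^ 2 := by
  have h1 : Tendsto (fun m : ℕ => (m : ℝ) ^ 2 * Real.exp (-r * m)) atTop (nhds 0) := by
    have h := (Real.tendsto_pow_mul_exp_neg_atTop_nhds_zero 2).comp
      ((tendsto_natCast_atTop_atTop (R := ℝ)).const_mul_atTop hr)
    have h' := h.const_mul (r ^ 2)⁻¹
    rw [mul_zero] at h'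
    refine h'.congr fun m => ?_
    simp only [Function.comp_apply]
    field_simp
  have h2 : Tendsto (fun m : ℕ => (m : ℝ)⁻¹) atTop (nhds 0) := tendsto_inv_atTop_nhds_zero_nat
  have h3 := (h1.const_mul (2 * a)).add (h2.const_mul (2 * b))
  simp only [mul_zero, add_zero] at h3
  filter_upwards [h3.eventually (eventually_le_nhds one_pos), eventually_gt_atTop 0] with m hm hm0
  have hm' : (0 : ℝ) < m := by exact_mod_cast hm0
  rw [le_div_iff₀ (by positivity)]
  refine le_trans (le_of_eq ?_) hm
  field_simp

end LRMC

/-! ### The risk bound -/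

open LRMC in
theorem mainTheorem3 {Ω : Type*} [MeasurableSpace Ω] (μ : Measure Ω) [IsProbabilityMeasure μ]
    {n k q : ℕ}
    -- low-fidelity outputs, response `f(Y)`, and the model index set
    (X : Ω → Fin n → ℝ) (hX : Measurable X)
    (fY : Ω → Fin k → ℝ) (hfY : Measurable fY)
    (S : Finset (Fin n)) (hS : S.Nonempty)
    -- linear model with centered sub-Gaussian noise that is independent of the regressors
    (β : Matrix (Fin k) (Option S) ℝ)
    (ε : Ω → Fin k → ℝ) (hε : Measurable ε)
    (hmodel : ∀ᵐ ω ∂μ, fY ω = β *ᵥ LRMC.regressor S (X ω) + ε ω)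
    (hindep : IndepFun ε (fun ω => LRMC.regressor S (X ω)) μ)
    (hsub : LRMC.IsSubGaussianVector ε μ)
    -- moment condition on the regressor vector
    (K : ℝ) (hK : 1 ≤ K)
    (hmoment : max
      (⨆ (θ : EuclideanSpace ℝ (Option S)) (_ : ‖θ‖ = 1),
        eLpNorm (fun ω => ∑ i, θ i * LRMC.regressor S (X ω) i) 4 μ)
      (LRMC.orliczNorm 1 (fun ω => ‖WithLp.toLp 2 (LRMC.regressor S (X ω))‖) μ)
        ≤ ENNReal.ofReal K)
    (hΛ : IsUnit (LRMC.secondMomentMatrix (fun ω => LRMC.regressor S (X ω)) μ))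
    -- i.i.d. exploration samples of all low-fidelity outputs and of the response
    (D : ℕ → Ω → (Fin n → ℝ) × (Fin k → ℝ)) (hD : ∀ l, Measurable (D l))
    (hDindep : iIndepFun D μ)
    (hDdist : ∀ l, IdentDistrib (D l) (fun ω => (X ω, fY ω)) μ μ)
    -- i.i.d. exploitation samples of the regressor vector, independent of the exploration
    (W : ℕ → Ω → Option S → ℝ) (hW : ∀ l, Measurable (W l))
    (hWindep : iIndepFun W μ)
    (hWdist : ∀ l, IdentDistrib (W l) (fun ω => LRMC.regressor S (X ω)) μ μ)
    (hDW : IndepFun (fun ω l => D l ω) (fun ω l => W l ω) μ)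
    -- sampling costs and the weight matrix of the risk
    (c₀ : ℝ) (hc₀ : 0 < c₀) (c : Fin n → ℝ) (hc : ∀ i, 0 < c i)
    (Q : Matrix (Fin q) (Fin k) ℝ) :
    ∃ C : ℝ, 0 < C ∧ ∀ᶠ m : ℕ in atTop, ∀ B : ℝ, 1 ≤ LRMC.numExploit c₀ c S B m →
      1 - 1 / (m : ℝ) ^ 2 ≤ μ.real {ω |
        LRMC.condRisk Q
            (fun ω' => LRMC.lrmc (LRMC.numExploit c₀ c S B m)
              (LRMC.lsCoef S m fun l => D l ω') fun l => W l ω')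
            (LRMC.meanVec fY μ)
            (fun ω' => LRMC.lsCoef S m fun l => D l ω') μ ω
          ≤ ENNReal.ofReal (C *
            (1 / (LRMC.numExploit c₀ c S B m : ℝ) *
                (LRMC.covMatrix (fun ω' => LRMC.regressor S (X ω')) μ * βᵀ * Qᵀ * Q * β).trace
              + ((S.card : ℝ) + 1) * (Q * LRMC.covMatrix ε μ * Qᵀ).trace
                * (Real.log m / m)))} := by
  set V : Ω → Option S → ℝ := fun ω => regressor S (X ω) with hVdef
  have hV : Measurable V := (measurable_regressor S).comp hX
  have hV2 : ∀ i, MemLp (fun ω => V ω i) 2 μ :=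
    memLp_two_of_iSup_eLpNorm_le hV ((le_max_left _ _).trans hmoment)
  obtain ⟨a, ha, haV⟩ :=
    exists_pos_mul_le_of_posSemidef (posSemidef_secondMomentMatrix hV2) hΛ
  -- the exploration samples as pairs of a regressor vector and a residual
  set φ : (Fin n → ℝ) × (Fin k → ℝ) → (Option S → ℝ) × (Fin k → ℝ) :=
    fun d => (regressor S d.1, d.2 - β *ᵥ regressor S d.1) with hφ
  have hφm : Measurable φ := by
    have h1 : Measurable fun d : (Fin n → ℝ) × (Fin k → ℝ) => regressor S d.1 :=
      (measurable_regressor S).comp measurable_fst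
    have h2 : Measurable fun x : Option S → ℝ => β *ᵥ x :=
      (Continuous.matrix_mulVec continuous_const continuous_id).measurable
    exact h1.prodMk (measurable_snd.sub (h2.comp h1))
  have hζdist : ∀ l, IdentDistrib (fun ω => φ (D l ω)) (fun ω => (V ω, ε ω)) μ μ := by
    intro l
    refine ((hDdist l).comp hφm).trans (IdentDistrib.of_ae_eq
      (hφm.comp (hX.prodMk hfY)).aemeasurable ?_)
    filter_upwards [hmodel] with ω hω
    change (V ω, fY ω - β *ᵥ V ω) = (V ω, ε ω)
    rw [hω, add_sub_cancel_left]
  have hζind : iIndepFun (fun l ω => φ (D l ω)) μ := hDindep.comp (fun _ => φ) fun _ => hφm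
  obtain ⟨ρ, hρ, hcoer⟩ := exists_measureReal_not_coercive_le hV hV2
    (ζ := fun l ω => regressor S (D l ω).1)
    (hζind.comp (fun _ => Prod.fst) fun _ => measurable_fst)
    (fun l => (hζdist l).comp measurable_fst) ha haV
  obtain ⟨A, hA, hnoise⟩ := exists_measureReal_lt_sq_sum_le hε hsub Q hV hindep.symm
    (fun l => hφm.comp (hD l)) hζind hζdist (b := 1 / (a / 2)) (by positivity)
  set γ := (Q * covMatrix ε μ * Qᵀ).trace with hγ
  have hγ0 : 0 ≤ γ := by
    rw [hγ, trace_covMatrix_eq_sum_variance hsub.memLp Q]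
    exact Finset.sum_nonneg fun r _ => variance_nonneg _ _
  set τ := fun N : ℕ => (1 / (N : ℝ)) * (covMatrix V μ * βᵀ * Qᵀ * Q * β).trace with hτ
  have hτ0 : ∀ N, 0 ≤ τ N := by
    intro N
    have h : 0 ≤ (covMatrix V μ * βᵀ * Qᵀ * Q * β).trace := by
      rw [trace_covMatrix_mul]
      refine Finset.sum_nonneg fun r _ => ?_
      rw [← variance_dotProduct hV2]
      exact variance_nonneg _ _
    positivity
  obtain ⟨M, hM0, hM⟩ : ∃ M : ℝ, 0 ≤ M ∧ ∀ i j, |secondMomentMatrix V μ i j| ≤ M := by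
    refine ⟨∑ i, ∑ j, |secondMomentMatrix V μ i j|, by positivity, fun i j => ?_⟩
    refine (Finset.single_le_sum (f := fun j => |secondMomentMatrix V μ i j|)
      (fun _ _ => abs_nonneg _) (Finset.mem_univ j)).trans ?_
    exact Finset.single_le_sum (f := fun i => ∑ j, |secondMomentMatrix V μ i j|)
      (fun _ _ => by positivity) (Finset.mem_univ i)
  set p : ℝ := (Fintype.card (Option S) : ℝ) with hp
  have hp0 : 0 ≤ p := by positivity
  -- The twos come from `(x + y)² ≤ 2 x² + 2 y²`. There are `q` rows, the form is at most `M p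
  -- ‖·‖²`, and each row has `p` entries with square at most `A γ log m / m`.
  refine ⟨2 + 2 * (q * (M * p * (p * A))), by positivity, ?_⟩
  filter_upwards [eventually_failure_prob_le (p ^ 2) (q * p) hρ, eventually_gt_atTop 0]
    with m hfail hm B hN
  set N := numExploit c₀ c S B m
  have hm0 : (0 : ℝ) < m := by exact_mod_cast hm
  have hlog : 0 ≤ Real.log m / m :=
    div_nonneg (Real.log_nonneg (by exact_mod_cast hm)) hm0.le
  set Z : Ω → Matrix (Fin m) (Option S) ℝ := fun ω => designMatrix S m fun l => (D l ω).1 with hZ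
  set η : Fin q → ℕ → Ω → ℝ := fun r l ω => (Q *ᵥ (φ (D l ω)).2) r with hη
  set E₀ : Set Ω := {ω | ¬ ∀ v : Option S → ℝ, (a / 2 * m) * ∑ i, v i ^ 2 ≤
    ∑ l : Fin m, (∑ i, regressor S (D l ω).1 i * v i) ^ 2} with hE₀
  -- The row length condition makes the noise bound applicable; off `E₀` it holds automatically.
  set E : Fin q × Option S → Set Ω := fun ri =>
    {ω | ∑ l, pinv (Z ω) ri.2 l ^ 2 ≤ 1 / (a / 2) / m ∧
      A * γ * (Real.log m / m) < (∑ l : Fin m, pinv (Z ω) ri.2 l * η ri.1 l ω) ^ 2} with hE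
  have hE₀le : μ.real E₀ ≤ p ^ 2 * (2 * Real.exp (-ρ * m)) := hcoer m hm
  have hEle : ∀ ri, μ.real (E ri) ≤ 2 / (m : ℝ) ^ 3 := fun ri =>
    hnoise m hm (fun x l => pinv (Matrix.of x) ri.2 l)
      ((measurable_pi_apply ri.2).comp (measurable_pinv_designMatrix S m)) ri.1
  -- the conditional risk is the risk with the estimated coefficients frozen
  have hb : Measurable fun ω (j : Fin k) (i : Option S) => lsCoef S m (fun l => D l ω) j i :=
    (measurable_lsCoef S m).comp (measurable_pi_lambda _ hD)
  have hF : Measurable fun x : (Fin k → Option S → ℝ) × (ℕ → Option S → ℝ) => ENNReal.ofReal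
      (‖WithLp.toLp 2 (Q *ᵥ (lrmc N (Matrix.of x.1) x.2 - meanVec fY μ))‖ ^ 2) := by
    have h1 : Continuous fun y : Fin k → ℝ =>
        ‖WithLp.toLp 2 (Q *ᵥ (y - meanVec fY μ))‖ ^ 2 := by
      refine Continuous.pow (Continuous.norm ((PiLp.continuous_toLp 2 _).comp ?_)) 2
      exact Continuous.matrix_mulVec continuous_const (by fun_prop)
    exact (h1.measurable.comp (measurable_lrmc N)).ennreal_ofReal
  have hrisk := condLExp_comp_of_indepFun hb (measurable_pi_lambda _ hW)
    (hDW.comp (measurable_lsCoef S m) measurable_id) hF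
  set G := {ω | condRisk Q (fun ω' => lrmc N (lsCoef S m fun l => D l ω') fun l => W l ω')
    (meanVec fY μ) (fun ω' => lsCoef S m fun l => D l ω') μ ω ≤
      ENNReal.ofReal ((2 + 2 * (q * (M * p * (p * A)))) *
        (τ N + ((S.card : ℝ) + 1) * γ * (Real.log m / m)))} with hG
  have hcover : ∀ᵐ ω ∂μ, ω ∈ G ∪ (E₀ ∪ ⋃ ri, E ri) := by
    filter_upwards [hrisk] with ω hω
    by_cases h0 : ω ∈ E₀
    · exact Or.inr (Or.inl h0)
    by_cases h1 : ω ∈ ⋃ ri, E ri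
    · exact Or.inr (Or.inr h1)
    refine Or.inl ?_
    have hco : ∀ v : Option S → ℝ, (a / 2 * m) * ∑ i, v i ^ 2 ≤ ∑ l, (Z ω *ᵥ v) l ^ 2 := by
      by_contra h
      exact h0 h
    have ham : 0 < a / 2 * m := by positivity
    have hinv := pinv_mul_self ham hco
    have herr : ∀ r i, (Q * (lsCoef S m (fun l => D l ω) - β)) r i ^ 2 ≤
        A * γ * (Real.log m / m) := by
      intro r i
      rw [mul_lsCoef_sub_apply S _ β Q hinv]
      by_contra! hlt
      refine h1 (Set.mem_iUnion.2 ⟨(r, i), ?_, hlt⟩)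
      rw [div_div]
      exact sum_sq_pinv_le ham hco i
    have hquad : ∑ r, (Q * (lsCoef S m (fun l => D l ω) - β)) r ⬝ᵥ
        secondMomentMatrix V μ *ᵥ (Q * (lsCoef S m (fun l => D l ω) - β)) r ≤
        q * (M * p * (p * A)) * (γ * (Real.log m / m)) := by
      have hr : ∀ r, (Q * (lsCoef S m (fun l => D l ω) - β)) r ⬝ᵥ
          secondMomentMatrix V μ *ᵥ (Q * (lsCoef S m (fun l => D l ω) - β)) r ≤
          M * p * (p * (A * γ * (Real.log m / m))) := by
        intro r
        have h2 := (le_abs_self _).trans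
          (abs_sum_mul_le hM ((Q * (lsCoef S m (fun l => D l ω) - β)) r))
        have h3 : ∑ i, (Q * (lsCoef S m (fun l => D l ω) - β)) r i ^ 2 ≤
            p * (A * γ * (Real.log m / m)) := by
          refine (Finset.sum_le_sum fun i _ => herr r i).trans_eq ?_
          rw [Finset.sum_const, Finset.card_univ, nsmul_eq_mul]
        refine (le_of_eq ?_).trans (h2.trans (mul_le_mul_of_nonneg_left h3 (by positivity)))
        simp only [dotProduct, Matrix.mulVec, Finset.mul_sum]
        exact Finset.sum_congr rfl fun i _ => Finset.sum_congr rfl fun j _ => by ring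
      refine (Finset.sum_le_sum fun r _ => hr r).trans_eq ?_
      rw [Finset.sum_const, Finset.card_univ, Fintype.card_fin, nsmul_eq_mul]
      ring
    have hbound := lintegral_sq_norm_lrmc_le hV2 hW hWindep hWdist Q
      (lsCoef S m fun l => D l ω) β hN
    rw [← meanVec_linear_model hV2 hmodel hsub] at hbound
    refine hω.le.trans (hbound.trans (ENNReal.ofReal_le_ofReal ?_))
    have hs : (0 : ℝ) ≤ S.card := Nat.cast_nonneg _
    have hL : 0 ≤ q * (M * p * (p * A)) := by positivity
    have hg : 0 ≤ γ * (Real.log m / m) := by positivity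
    have ht := hτ0 N
    change 2 * τ N + _ ≤ _
    -- The constant already contains the dimension, so the factor `S.card + 1 ≥ 1` is slack here.
    nlinarith [mul_nonneg hL ht, mul_nonneg hL hg, mul_nonneg hs hg,
      mul_nonneg hL (mul_nonneg hs hg)]
  -- Subadditivity suffices, so measurability of `G` and of the bad events plays no role.
  have hone : 1 ≤ μ.real G + (μ.real E₀ + ∑ ri, μ.real (E ri)) := by
    calc 1 = μ.real Set.univ := probReal_univ.symm
      _ = μ.real (G ∪ (E₀ ∪ ⋃ ri, E ri)) := by
          refine measureReal_congr ?_
          filter_upwards [hcover] with ω hω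
          exact propext ⟨fun _ => hω, fun _ => trivial⟩
      _ ≤ μ.real G + (μ.real E₀ + μ.real (⋃ ri, E ri)) :=
          (measureReal_union_le _ _).trans (by gcongr; exact measureReal_union_le _ _)
      _ ≤ _ := by gcongr; exact measureReal_iUnion_fintype_le E
  have hsum : ∑ ri, μ.real (E ri) ≤ q * p * (2 / (m : ℝ) ^ 3) := by
    refine (Finset.sum_le_sum fun ri _ => hEle ri).trans_eq ?_
    rw [Finset.sum_const, Finset.card_univ, Fintype.card_prod, Fintype.card_fin, nsmul_eq_mul]
    push_cast
    rfl
  linarith
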